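/- There is an absolute constant $C>0$ and, for every $\alpha\in(0,2]$, a constant $C(\alpha)>0$ depending only on $\alpha$ such that the following holds. For a real random variable $\xi$ put $\|\xi\|_{\psi_\alpha}:=\inf\{t>0:\ \mathsf E\exp(|\xi/t|^\alpha)\le 2\}$, and for a random vector $X$ in $\mathbb R^m$ put $\|X\|_{\psi_\alpha}:=\sup_{\|v\|_2=1}\|\langle X,v\rangle\|_{\psi_\alpha}$. For $T\subset\mathbb R^n$ let $\mathrm{rad}(T):=\sup_{t\in T}\|t\|_2$ and let $$\gamma_\alpha(T):=\inf\ \sup_{t\in T}\ \sum_{k\ge 0}2^{k/\alpha}\,\mathrm{diam}(\mathcal A_k(t)),$$ where the infimum is over all sequences $(\mathcal A_k)_{k\ge0}$ of partitions of $T$ such that $\mathcal A_{k+1}$ refines $\mathcal A_k$ for every $k\ge0$, $|\mathcal A_0|=1$ and $|\mathcal A_k|\le 2^{2^k}$ for $k\ge1$; here $\mathcal A_k(t)$ is the cell of $\mathcal A_k$ that contains $t$, and $\mathrm{diam}$ is the Euclidean diameter. Let $A\in\mathbb R^{m\times n}$ be a random matrix whose columns $A_1,\dots,A_n$ are independent,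 mean-zero random vectors in $\mathbb R^m$, and let $\lambda>0$ and $K\ge0$. Assume that $\|A_i\|_2=\lambda$ almost surely and $\|A_i\|_{\psi_\alpha}\le K$ for every $i$. Then for every set $T\subset\mathbb R^n$ (all quantities being taken in $[0,\infty]$; for non-empty bounded $T$ they are finite) $$\mathsf E\sup_{x\in T}\bigl|\,\|Ax\|_2-\lambda\|x\|_2\,\bigr|\ \le\ C(\alpha)\,K\,\bigl(\gamma_\alpha(T)+\mathrm{rad}(T)\bigr).$$ Moreover, for every $u\ge0$, with probability at least $1-Ce^{-u^\alpha}$, $$\sup_{x\in T}\bigl|\,\|Ax\|_2-\lambda\|x\|_2\,\bigr|\ \le\ C(\alpha)\,K\,\bigl(\gamma_\alpha(T)+u\cdot\mathrm{rad}(T)\bigr).$$ -/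

import Mathlib

open MeasureTheory ProbabilityTheory
open scoped ENNReal NNReal Matrix

noncomputable section

/-- The `ψ_α` norm (quasi-norm when `α < 1`) of a real random variable `ξ`, with values in
`[0, ∞]`: the infimum of all `t > 0` such that `E exp (|ξ / t| ^ α) ≤ 2`
(it is `∞` if there is no such `t`). -/
def psiNorm {Ω : Type*} [MeasurableSpace Ω] (P : Measure Ω) (α : ℝ) (ξ : Ω → ℝ) : ℝ≥0∞ :=
  ⨅ (t : ℝ) (_ : 0 < t) (_ : ∫⁻ ω, ENNReal.ofReal (Real.exp (|ξ ω / t| ^ α)) ∂P ≤ 2),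
    ENNReal.ofReal t

/-- The `ψ_α` norm of a random vector in `ℝ^m`: the supremum of the `ψ_α` norms of its
one-dimensional marginals in the directions of the Euclidean unit sphere. -/
def psiNormVec {Ω : Type*} [MeasurableSpace Ω] (P : Measure Ω) (α : ℝ) {m : ℕ}
    (ξ : Ω → EuclideanSpace ℝ (Fin m)) : ℝ≥0∞ :=
  ⨆ x ∈ Metric.sphere (0 : EuclideanSpace ℝ (Fin m)) 1, psiNorm P α (fun ω => inner ℝ (ξ ω) x)

/-- An admissible sequence of partitions of `X`: an increasing sequence of partitions
(every cell of the next partition lies in a cell of the present one) such that the first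
one has one cell and the `k`-th one has at most `2 ^ (2 ^ k)` cells for `k ≥ 1`. -/
structure IsAdmissibleSeq {X : Type*} (𝒜 : ℕ → Set (Set X)) : Prop where
  isPartition : ∀ k, Setoid.IsPartition (𝒜 k)
  refine_succ : ∀ k, ∀ B ∈ 𝒜 (k + 1), ∃ A ∈ 𝒜 k, B ⊆ A
  card_zero : (𝒜 0).encard = 1
  card_le : ∀ k, 1 ≤ k → (𝒜 k).encard ≤ 2 ^ (2 ^ k)

/-- The cell of the partition `c` that contains the point `t`. -/
def partitionCell {X : Type*} (c : Set (Set X)) (t : X) : Set X :=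
  {s | ∃ A ∈ c, t ∈ A ∧ s ∈ A}

/-- Talagrand's functional `γ_α(X, d)` of a metric space, with values in `[0, ∞]`. -/
def talagrandGamma (α : ℝ) (X : Type*) [MetricSpace X] : ℝ≥0∞ :=
  ⨅ (𝒜 : ℕ → Set (Set X)) (_ : IsAdmissibleSeq 𝒜),
    ⨆ t : X, ∑' k : ℕ,
      ENNReal.ofReal ((2 : ℝ) ^ ((k : ℝ) / α)) * Metric.ediam (partitionCell (𝒜 k) t)

/-- The radius `sup_{t ∈ T} ‖t‖₂`, with values in `[0, ∞]`. -/
def setRad {n : ℕ} (T : Set (EuclideanSpace ℝ (Fin n))) : ℝ≥0∞ :=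
  ⨆ t ∈ T, ENNReal.ofReal ‖t‖

/-- The `i`-th column of a matrix, as a vector of the Euclidean space `ℝ^m`. -/
def euclideanCol {m n : ℕ} (M : Matrix (Fin m) (Fin n) ℝ) (i : Fin n) :
    EuclideanSpace ℝ (Fin m) :=
  WithLp.toLp 2 (fun j => M j i)

/-- The distortion `sup_{x ∈ T} |‖M x‖₂ - r ‖x‖₂|`, with values in `[0, ∞]`. -/
def supDistortion {m n : ℕ} (M : Matrix (Fin m) (Fin n) ℝ) (r : ℝ)
    (T : Set (EuclideanSpace ℝ (Fin n))) : ℝ≥0∞ :=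
  ⨆ x ∈ T, ENNReal.ofReal
    |‖(WithLp.toLp 2 (M *ᵥ x.ofLp) : EuclideanSpace ℝ (Fin m))‖ - r * ‖x‖|

end

/-! Write `Z_x = ‖Ax‖ - λ‖x‖`. Everything rests on the increment bound `‖Z_x - Z_y‖_p ≲ p^(1/α) K ‖x
- y‖` (`IsWeibullColumns.lpNorm_colDeviation_sub_le`) and its one-point version; generic chaining
over moments does the rest.

Because the columns have norm exactly `λ`, the form `⟨Au, Av⟩ - λ²⟨u, v⟩` has no diagonal. It is
therefore an average of decoupled forms `⟨A_I u, A_{Iᶜ} v⟩`. Given the columns outside `I`, such a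
form is a sum of independent centred `ψ_α` variables, whose `p`-th moment is of order `p^(1/α) K ‖u‖
‖A_{Iᶜ} v‖`; here `α ≤ 2` makes the Euclidean norm of `u` suffice. If `M` is the best constant in
`‖‖Ax‖‖_p ≤ M‖x‖` and `D` is of order `p^(1/α) K`, the case `u = v` gives `M² ≤ λ² + 4DM`, hence `M
≤ λ + 4D`.

To pass from squares to norms, divide by `λ(‖x‖ + ‖y‖)`. This is affordable when `D ≲ λ`; for larger
`D` the triangle inequality already gives the right order.

For the chaining (`exists_chaining_control`), suitable powers of all normalised increments are
summed into one variable `Y` of mean at most 3. The expectation bound integrates `Y`, and the tail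
bound is Markov's inequality for `Y`. -/

/-! ### Convexity of even powers -/

lemma even_pow_tangent_le (q : ℕ) (x h : ℝ) :
    x ^ (2 * q) + (2 * q : ℕ) * x ^ (2 * q - 1) * h ≤ (x + h) ^ (2 * q) := by
  have hc : ConvexOn ℝ Set.univ (fun z : ℝ => z ^ (2 * q)) := (even_two_mul q).convexOn_pow
  have hd : HasDerivAt (fun z : ℝ => z ^ (2 * q)) ((2 * q : ℕ) * x ^ (2 * q - 1)) x :=
    hasDerivAt_pow (2 * q) x
  rcases lt_trichotomy h 0 with hh | rfl | hh
  · have := hc.slope_le_of_hasDerivAt (Set.mem_univ (x + h)) (Set.mem_univ x) (by linarith) hd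
    rw [slope_def_field, div_le_iff₀ (by linarith)] at this
    linarith
  · simp
  · have := hc.le_slope_of_hasDerivAt (Set.mem_univ x) (Set.mem_univ (x + h)) (by linarith) hd
    rw [slope_def_field, le_div_iff₀ (by linarith)] at this
    linarith

/-- A pointwise substitute for symmetrisation: the term linear in `y` vanishes in mean when `y` is
centred and independent of `x`, and the rest is even in `y`. It combines midpoint convexity between
`x` and `x + 2y` with the tangent at `x` evaluated at `x - 2y`. -/
lemma even_pow_add_le (q : ℕ) (x y : ℝ) :
    (x + y) ^ (2 * q) ≤ (2 * q : ℕ) * (x ^ (2 * q - 1) * y) +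
      ((x + 2 * y) ^ (2 * q) + (x - 2 * y) ^ (2 * q)) / 2 := by
  have h1 := even_pow_tangent_le q x (-(2 * y))
  have h2 := ((even_two_mul q).convexOn_pow (𝕜 := ℝ)).2 (Set.mem_univ x)
    (Set.mem_univ (x + 2 * y)) (by norm_num : (0 : ℝ) ≤ 1 / 2) (by norm_num : (0 : ℝ) ≤ 1 / 2)
    (by norm_num)
  simp only [smul_eq_mul] at h2
  rw [show (1 : ℝ) / 2 * x + 1 / 2 * (x + 2 * y) = x + y by ring] at h2
  rw [← sub_eq_add_neg] at h1
  linarith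

lemma sum_range_even_terms (q : ℕ) (g : ℕ → ℝ) :
    ∑ j ∈ Finset.range (2 * q + 1), g j * ((1 + (-1) ^ j) / 2) =
      ∑ k ∈ Finset.range (q + 1), g (2 * k) := by
  induction q with
  | zero => simp
  | succ q ih =>
    rw [show 2 * (q + 1) + 1 = 2 * q + 1 + 1 + 1 by ring, Finset.sum_range_succ,
      Finset.sum_range_succ, ih, Finset.sum_range_succ _ (q + 1)]
    rw [show 2 * q + 1 + 1 = 2 * (q + 1) by ring]
    simp [pow_add, pow_mul]

lemma even_pow_symm_expansion (q : ℕ) (x z : ℝ) :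
    ((x + z) ^ (2 * q) + (x - z) ^ (2 * q)) / 2 =
      ∑ k ∈ Finset.range (q + 1),
        ((2 * q).choose (2 * k) : ℝ) * (x ^ (2 * (q - k)) * z ^ (2 * k)) := by
  have h1 : (x + z) ^ (2 * q) = ∑ j ∈ Finset.range (2 * q + 1),
      ((2 * q).choose j : ℝ) * (x ^ (2 * q - j) * z ^ j) := by
    rw [add_comm, add_pow]
    exact Finset.sum_congr rfl fun j _ => by ring
  have h2 : (x - z) ^ (2 * q) = ∑ j ∈ Finset.range (2 * q + 1),
      ((2 * q).choose j : ℝ) * (x ^ (2 * q - j) * z ^ j) * (-1) ^ j := by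
    rw [sub_eq_add_neg, add_comm, add_pow]
    exact Finset.sum_congr rfl fun j _ => by rw [neg_pow]; ring
  have h3 := sum_range_even_terms q fun j => ((2 * q).choose j : ℝ) * (x ^ (2 * q - j) * z ^ j)
  simp only [Nat.mul_sub]
  rw [← h3, h1, h2, ← Finset.sum_add_distrib, Finset.sum_div]
  exact Finset.sum_congr rfl fun j _ => by ring

/-! ### Even moments of sums of independent centred variables -/

section Moments

variable {Ω : Type*} [MeasurableSpace Ω] {P : Measure Ω}

lemma memLp_top_pow {f : Ω → ℝ} (hf : MemLp f ∞ P) (n : ℕ) : MemLp (fun ω => f ω ^ n) ∞ P := by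
  induction n with
  | zero => simpa using memLp_top_const (1 : ℝ)
  | succ n ih =>
    simp only [pow_succ]
    exact hf.mul' ih

variable [IsProbabilityMeasure P]

lemma integral_even_pow_add_le {X Y : Ω → ℝ} (hX : MemLp X ∞ P) (hY : MemLp Y ∞ P)
    (h : IndepFun X Y P) (hY0 : ∫ ω, Y ω ∂P = 0) (q : ℕ) :
    ∫ ω, (X ω + Y ω) ^ (2 * q) ∂P ≤ ∑ k ∈ Finset.range (q + 1),
      ((2 * q).choose (2 * k) : ℝ) *
        ((∫ ω, X ω ^ (2 * (q - k)) ∂P) * (4 ^ k * ∫ ω, Y ω ^ (2 * k) ∂P)) := by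
  have hint : ∀ {f : Ω → ℝ}, MemLp f ∞ P → Integrable f P := fun hf => hf.integrable le_top
  have hprod : ∀ a b : ℕ, ∫ ω, X ω ^ a * Y ω ^ b ∂P = (∫ ω, X ω ^ a ∂P) * ∫ ω, Y ω ^ b ∂P := by
    intro a b
    exact (h.comp (φ := fun x => x ^ a) (ψ := fun x => x ^ b) (by fun_prop)
      (by fun_prop)).integral_fun_mul_eq_mul_integral
      (memLp_top_pow hX a).1 (memLp_top_pow hY b).1
  have hmul : ∀ a b : ℕ, MemLp (fun ω => X ω ^ a * Y ω ^ b) ∞ P := fun a b =>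
    (memLp_top_pow hY b).mul' (memLp_top_pow hX a)
  have hterm : ∀ k ∈ Finset.range (q + 1), Integrable (fun ω => ((2 * q).choose (2 * k) : ℝ) *
      (X ω ^ (2 * (q - k)) * (2 * Y ω) ^ (2 * k))) P := by
    intro k _
    refine ((hint (hmul (2 * (q - k)) (2 * k))).const_mul
      (((2 * q).choose (2 * k) : ℝ) * 2 ^ (2 * k))).congr (Filter.Eventually.of_forall fun ω => ?_)
    simp only [mul_pow]; ring
  have hlin : Integrable (fun ω => ((2 * q : ℕ) : ℝ) * (X ω ^ (2 * q - 1) * Y ω)) P := by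
    simpa using (hint (hmul (2 * q - 1) 1)).const_mul ((2 * q : ℕ) : ℝ)
  calc ∫ ω, (X ω + Y ω) ^ (2 * q) ∂P
      ≤ ∫ ω, (((2 * q : ℕ) : ℝ) * (X ω ^ (2 * q - 1) * Y ω) +
          ∑ k ∈ Finset.range (q + 1), ((2 * q).choose (2 * k) : ℝ) *
            (X ω ^ (2 * (q - k)) * (2 * Y ω) ^ (2 * k))) ∂P := by
        refine integral_mono (hint (memLp_top_pow (hX.add hY) _))
          (hlin.add (integrable_finsetSum _ hterm)) fun ω => ?_
        have := even_pow_add_le q (X ω) (Y ω)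
        rw [even_pow_symm_expansion] at this
        exact this
    _ = _ := by
        rw [integral_add hlin (integrable_finsetSum _ hterm), integral_finsetSum _ hterm,
          integral_const_mul]
        have h0 := hprod (2 * q - 1) 1
        simp only [pow_one] at h0
        rw [h0, hY0, mul_zero, mul_zero, zero_add]
        refine Finset.sum_congr rfl fun k _ => ?_
        rw [integral_const_mul]
        congr 1
        rw [← integral_const_mul, ← integral_const_mul]
        rw [show (∫ ω, X ω ^ (2 * (q - k)) * (2 * Y ω) ^ (2 * k) ∂P) =
          ∫ ω, 4 ^ k * (X ω ^ (2 * (q - k)) * Y ω ^ (2 * k)) ∂P by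
            congr 1; ext ω; rw [mul_pow, pow_mul 2 2 k]; ring]
        rw [integral_const_mul, hprod, integral_const_mul, integral_const_mul]; ring

/-- The normalisation of the `2k`-th moment of sums of independent `ψ_α` variables;
`β = 1 / α - 1 / 2`. -/
noncomputable def momentWeight (β : ℝ) (k : ℕ) : ℝ :=
  ((2 * k).factorial : ℝ) ^ β * ((2 * k).factorial / k.factorial)

/-- The ratios `(2k)!/k!` turn `(2q).choose (2k)` into `q.choose k` exactly. The powers `((2k)!)^β`
only help, since `(2k)! (2(q-k))! ≤ (2q)!` and `β ≥ 0`; this is where `α ≤ 2` is needed. -/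
lemma momentWeight_mul_le {β : ℝ} (hβ : 0 ≤ β) {q k : ℕ} (hk : k ≤ q) :
    ((2 * q).choose (2 * k) : ℝ) * (momentWeight β (q - k) * momentWeight β k) ≤
      momentWeight β q * q.choose k := by
  have hc : ((2 * q).choose (2 * k) : ℝ) * (2 * k).factorial * (2 * (q - k)).factorial =
      (2 * q).factorial := by
    have := Nat.choose_mul_factorial_mul_factorial (show 2 * k ≤ 2 * q by omega)
    rw [← Nat.mul_sub] at this
    exact_mod_cast this
  have hc' : (q.choose k : ℝ) * k.factorial * (q - k).factorial = q.factorial := by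
    exact_mod_cast Nat.choose_mul_factorial_mul_factorial hk
  have hpow : ((2 * (q - k)).factorial : ℝ) ^ β * ((2 * k).factorial : ℝ) ^ β ≤
      ((2 * q).factorial : ℝ) ^ β := by
    rw [← Real.mul_rpow (by positivity) (by positivity)]
    refine Real.rpow_le_rpow (by positivity) ?_ hβ
    rw [← hc]
    have : (1 : ℝ) ≤ (2 * q).choose (2 * k) := by
      exact_mod_cast Nat.choose_pos (by omega)
    nlinarith [show (0 : ℝ) < (2 * k).factorial * (2 * (q - k)).factorial by positivity]
  unfold momentWeight
  calc _ = (((2 * (q - k)).factorial : ℝ) ^ β * ((2 * k).factorial : ℝ) ^ β) *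
        (((2 * q).choose (2 * k) : ℝ) * (2 * k).factorial * (2 * (q - k)).factorial /
          (k.factorial * (q - k).factorial)) := by field_simp
    _ ≤ ((2 * q).factorial : ℝ) ^ β * (((2 * q).choose (2 * k) : ℝ) * (2 * k).factorial *
        (2 * (q - k)).factorial / (k.factorial * (q - k).factorial)) := by gcongr
    _ = _ := by
        rw [hc, mul_assoc]
        congr 1
        rw [← hc']
        have : (q.choose k : ℝ) ≠ 0 := by exact_mod_cast (Nat.choose_pos hk).ne'
        field_simp

lemma momentWeight_pos (β : ℝ) (k : ℕ) : 0 < momentWeight β k := by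
  unfold momentWeight; positivity

/-- Adding one summand at a time, `momentWeight_mul_le` makes the expansion collapse into the
binomial formula for `(∑ τ + τ i)^q`, so no constant is lost in the induction. The factor `4^k` in
the hypothesis pays for the `2y` of `even_pow_add_le`. -/
lemma integral_even_pow_sum_le {ι : Type*} {ξ : ι → Ω → ℝ} {τ : ι → ℝ} {β : ℝ} (hβ : 0 ≤ β)
    (hξ : ∀ i, MemLp (ξ i) ∞ P) (hind : iIndepFun ξ P) (h0 : ∀ i, ∫ ω, ξ i ω ∂P = 0)
    (hτ : ∀ i, 0 ≤ τ i)
    (hmom : ∀ i k, 4 ^ k * ∫ ω, ξ i ω ^ (2 * k) ∂P ≤ momentWeight β k * τ i ^ k)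
    (s : Finset ι) (q : ℕ) :
    ∫ ω, (∑ i ∈ s, ξ i ω) ^ (2 * q) ∂P ≤ momentWeight β q * (∑ i ∈ s, τ i) ^ q := by
  classical
  induction s using Finset.induction_on generalizing q with
  | empty =>
    rcases q with _ | q
    · simp [momentWeight]
    · simp
  | insert i s his ih =>
    have hind' : IndepFun (fun ω => ∑ j ∈ s, ξ j ω) (ξ i) P := by
      have := hind.indepFun_finsetSum_of_notMem₀ (fun j => (hξ j).1.aemeasurable) his
      convert this using 1
      ext ω; simp
    have hs : MemLp (fun ω => ∑ j ∈ s, ξ j ω) ∞ P := memLp_finsetSum s fun j _ => hξ j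
    have hstep := integral_even_pow_add_le hs (hξ i) hind' (h0 i) q
    simp only [Finset.sum_insert his]
    simp only [add_comm (ξ i _)]
    refine hstep.trans ?_
    rw [add_pow, Finset.mul_sum]
    refine Finset.sum_le_sum fun k hk => ?_
    have hk' : k ≤ q := by simpa [Nat.lt_succ_iff] using hk
    have hT : 0 ≤ ∑ j ∈ s, τ j := Finset.sum_nonneg fun j _ => hτ j
    calc _ ≤ ((2 * q).choose (2 * k) : ℝ) *
          ((momentWeight β (q - k) * (∑ j ∈ s, τ j) ^ (q - k)) *
            (momentWeight β k * τ i ^ k)) := by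
          refine mul_le_mul_of_nonneg_left ?_ (by positivity)
          refine mul_le_mul (ih _) (hmom i k) ?_ ?_
          · exact mul_nonneg (by positivity) (integral_nonneg fun ω => (even_two_mul k).pow_nonneg _)
          · exact mul_nonneg (momentWeight_pos _ _).le (by positivity)
      _ = ((2 * q).choose (2 * k) : ℝ) * (momentWeight β (q - k) * momentWeight β k) *
          ((∑ j ∈ s, τ j) ^ (q - k) * τ i ^ k) := by ring
      _ ≤ momentWeight β q * q.choose k * ((∑ j ∈ s, τ j) ^ (q - k) * τ i ^ k) := by
          refine mul_le_mul_of_nonneg_right (momentWeight_mul_le hβ hk') ?_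
          have := hτ i
          positivity
      _ = momentWeight β q * ((τ i) ^ k * (∑ j ∈ s, τ j) ^ (q - k) * q.choose k) := by ring

end Moments

/-! ### From `ψ_α` norms to moments -/

/-- This is `z^p / p! ≤ exp z` at `z = α y^α`, raised to the power `1/α`. -/
lemma pow_le_rpow_mul_exp {α y : ℝ} (hα : 0 < α) (hy : 0 ≤ y) (p : ℕ) :
    y ^ p ≤ (α ^ (-1 / α)) ^ p * (p.factorial : ℝ) ^ (1 / α) * Real.exp (y ^ α) := by
  have hz : 0 ≤ y ^ α := Real.rpow_nonneg hy _
  have h1 : (α * y ^ α) ^ p ≤ p.factorial * Real.exp (α * y ^ α) := by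
    have := Real.pow_div_factorial_le_exp (α * y ^ α) (by positivity) p
    rwa [div_le_iff₀ (by positivity), mul_comm (Real.exp _)] at this
  have h2 := Real.rpow_le_rpow (by positivity) h1 (show 0 ≤ 1 / α by positivity)
  rw [Real.mul_rpow (by positivity) (by positivity), ← Real.exp_mul,
    show α * y ^ α * (1 / α) = y ^ α by field_simp, mul_pow,
    Real.mul_rpow (by positivity) (by positivity)] at h2
  have h3 : ((y ^ α) ^ p : ℝ) ^ (1 / α) = y ^ p := by
    rw [← Real.rpow_natCast, ← Real.rpow_mul hy, ← Real.rpow_mul hy, ← Real.rpow_natCast]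
    congr 1; field_simp
  have h4 : (α ^ (-1 / α)) ^ p * (α ^ p : ℝ) ^ (1 / α) = 1 := by
    rw [← Real.rpow_natCast, ← Real.rpow_natCast, ← Real.rpow_mul hα.le, ← Real.rpow_mul hα.le,
      ← Real.rpow_add hα]
    convert Real.rpow_zero α using 2
    field_simp; ring
  rw [h3] at h2
  calc y ^ p = (α ^ (-1 / α)) ^ p * ((α ^ p : ℝ) ^ (1 / α) * y ^ p) := by
        rw [← mul_assoc, h4, one_mul]
    _ ≤ (α ^ (-1 / α)) ^ p * ((p.factorial : ℝ) ^ (1 / α) * Real.exp (y ^ α)) := by gcongr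
    _ = _ := by ring

lemma factorial_rpow_le_momentWeight {α : ℝ} (k : ℕ) :
    ((2 * k).factorial : ℝ) ^ (1 / α) ≤ momentWeight (1 / α - 1 / 2) k := by
  have hpos : (0 : ℝ) < (2 * k).factorial := by positivity
  have h1 : ((2 * k).factorial : ℝ) ^ (1 / α) =
      ((2 * k).factorial : ℝ) ^ (1 / α - 1 / 2) * ((2 * k).factorial : ℝ) ^ (1 / 2 : ℝ) := by
    rw [← Real.rpow_add hpos]; congr 1; ring
  rw [h1, momentWeight, ← Real.sqrt_eq_rpow]
  gcongr
  rw [le_div_iff₀ (by positivity)]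
  have h2 : (k.factorial : ℝ) ^ 2 ≤ (2 * k).factorial := by
    have := Nat.factorial_mul_factorial_dvd_factorial_add k k
    have := Nat.le_of_dvd (by positivity) this
    rw [← two_mul] at this
    rw [pow_two]; exact_mod_cast this
  calc √((2 * k).factorial : ℝ) * k.factorial
      ≤ √((2 * k).factorial : ℝ) * √((2 * k).factorial : ℝ) := by
        gcongr; exact Real.le_sqrt_of_sq_le h2
    _ = _ := Real.mul_self_sqrt hpos.le

/-- The exponents add up: `2q (1/α - 1/2)` from the factorial power and `q` from `(2q)!/q! ≤
(2q)^q`. -/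
lemma momentWeight_le {α : ℝ} (hα : 0 < α) (hα2 : α ≤ 2) {q : ℕ} (hq : 1 ≤ q) :
    momentWeight (1 / α - 1 / 2) q ≤ (((2 * q : ℕ) : ℝ) ^ (1 / α)) ^ (2 * q) := by
  have hβ : 0 ≤ 1 / α - 1 / 2 := by
    have := one_div_le_one_div_of_le hα hα2; linarith
  have hN : (0 : ℝ) < (2 * q : ℕ) := by exact_mod_cast (by omega)
  have h1 : ((2 * q).factorial : ℝ) ≤ ((2 * q : ℕ) : ℝ) ^ (2 * q) := by
    exact_mod_cast Nat.factorial_le_pow (2 * q)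
  have h2 : ((2 * q).factorial : ℝ) / q.factorial ≤ ((2 * q : ℕ) : ℝ) ^ q := by
    rw [div_le_iff₀ (by positivity), mul_comm (_ ^ _)]
    have h := Nat.factorial_mul_descFactorial (show q ≤ 2 * q by omega)
    rw [show 2 * q - q = q by omega] at h
    rw [← h]
    exact_mod_cast Nat.mul_le_mul_left _ (Nat.descFactorial_le_pow _ _)
  calc momentWeight (1 / α - 1 / 2) q
      ≤ (((2 * q : ℕ) : ℝ) ^ (2 * q)) ^ (1 / α - 1 / 2) * ((2 * q : ℕ) : ℝ) ^ q := by
        unfold momentWeight; gcongr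
    _ = _ := by
        rw [← Real.rpow_natCast, ← Real.rpow_natCast, ← Real.rpow_natCast, ← Real.rpow_mul hN.le,
          ← Real.rpow_mul hN.le, ← Real.rpow_add hN]
        congr 1; push_cast; ring

section Psi

variable {Ω : Type*} [MeasurableSpace Ω] {P : Measure Ω} [IsProbabilityMeasure P]

lemma integral_even_pow_le_of_psiNorm_le {α : ℝ} (hα : 0 < α) {ξ : Ω → ℝ} (hξ : MemLp ξ ∞ P)
    {K : ℝ} (hK : 0 < K) (h : psiNorm P α ξ ≤ ENNReal.ofReal K) (k : ℕ) :
    4 ^ k * ∫ ω, ξ ω ^ (2 * k) ∂P ≤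
      momentWeight (1 / α - 1 / 2) k * (32 * (α ^ (-1 / α)) ^ 2 * K ^ 2) ^ k := by
  rcases Nat.eq_zero_or_pos k with rfl | hk
  · simp [momentWeight]
  -- Doubling `K` makes the inequality strict, so the infimum yields an actual admissible `t`.
  have hlt : psiNorm P α ξ < ENNReal.ofReal (2 * K) :=
    h.trans_lt ((ENNReal.ofReal_lt_ofReal_iff (by linarith)).2 (by linarith))
  simp only [psiNorm, iInf_lt_iff] at hlt
  obtain ⟨t, ht, hexp, htK⟩ := hlt
  have htK' : t < 2 * K := (ENNReal.ofReal_lt_ofReal_iff (by linarith)).1 htK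
  set c := α ^ (-1 / α) with hc
  have hc0 : 0 < c := Real.rpow_pos_of_pos hα _
  have hpt : ∀ ω, ξ ω ^ (2 * k) ≤ (t * c) ^ (2 * k) * ((2 * k).factorial : ℝ) ^ (1 / α) *
      Real.exp (|ξ ω / t| ^ α) := by
    intro ω
    have := pow_le_rpow_mul_exp hα (abs_nonneg (ξ ω / t)) (2 * k)
    rw [Even.pow_abs (even_two_mul k), div_pow, div_le_iff₀ (by positivity)] at this
    refine this.trans (le_of_eq ?_)
    rw [mul_pow]; ring
  have hI : ∫ ω, ξ ω ^ (2 * k) ∂P ≤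
      (t * c) ^ (2 * k) * ((2 * k).factorial : ℝ) ^ (1 / α) * 2 := by
    rw [integral_eq_lintegral_of_nonneg_ae
      (Filter.Eventually.of_forall fun ω => (even_two_mul k).pow_nonneg _)
      (memLp_top_pow hξ _).1]
    refine ENNReal.toReal_le_of_le_ofReal (by positivity) ?_
    calc ∫⁻ ω, ENNReal.ofReal (ξ ω ^ (2 * k)) ∂P
        ≤ ∫⁻ ω, ENNReal.ofReal ((t * c) ^ (2 * k) * ((2 * k).factorial : ℝ) ^ (1 / α)) *
            ENNReal.ofReal (Real.exp (|ξ ω / t| ^ α)) ∂P := by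
          refine lintegral_mono fun ω => ?_
          rw [← ENNReal.ofReal_mul (by positivity)]
          exact ENNReal.ofReal_le_ofReal (hpt ω)
      _ ≤ ENNReal.ofReal ((t * c) ^ (2 * k) * ((2 * k).factorial : ℝ) ^ (1 / α)) * 2 := by
          rw [lintegral_const_mul' _ _ ENNReal.ofReal_ne_top]
          gcongr
      _ = _ := by
          rw [ENNReal.ofReal_mul (by positivity) (q := 2)]; simp
  -- The bound 2 on the exponential moment is absorbed into a `k`-th power, which needs `k ≥ 1`.
  -- Thus `32 = 4 · 2² · 2`.
  have h2 : (2 : ℝ) ≤ 2 ^ k := by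
    calc (2 : ℝ) = 2 ^ 1 := by norm_num
      _ ≤ 2 ^ k := pow_le_pow_right₀ (by norm_num) hk
  calc 4 ^ k * ∫ ω, ξ ω ^ (2 * k) ∂P
      ≤ 4 ^ k * (((2 * K) * c) ^ (2 * k) * momentWeight (1 / α - 1 / 2) k * 2 ^ k) := by
        gcongr
        refine hI.trans ?_
        gcongr
        · exact mul_nonneg (by positivity) (momentWeight_pos _ _).le
        · exact factorial_rpow_le_momentWeight k
    _ = _ := by
        rw [show 32 * c ^ 2 * K ^ 2 = 4 * (2 * K * c) ^ 2 * 2 by ring, mul_pow _ 2, mul_pow 4,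
          ← pow_mul]
        ring

/-- Marginal moments of a vector with `ψ_α` norm at most `K`, in every direction. -/
lemma integral_inner_even_pow_le {α : ℝ} (hα : 0 < α) {m : ℕ}
    {X : Ω → EuclideanSpace ℝ (Fin m)} (hX : MemLp X ∞ P) {K : ℝ} (hK : 0 < K)
    (h : psiNormVec P α X ≤ ENNReal.ofReal K) (w : EuclideanSpace ℝ (Fin m)) (k : ℕ) :
    4 ^ k * ∫ ω, (inner ℝ (X ω) w : ℝ) ^ (2 * k) ∂P ≤
      momentWeight (1 / α - 1 / 2) k * (32 * (α ^ (-1 / α)) ^ 2 * K ^ 2 * ‖w‖ ^ 2) ^ k := by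
  rcases eq_or_ne w 0 with rfl | hw
  · rcases Nat.eq_zero_or_pos k with rfl | hk
    · simp [momentWeight]
    · simp [hk.ne']
  have hw0 : 0 < ‖w‖ := norm_pos_iff.2 hw
  set v := ‖w‖⁻¹ • w with hv
  have hv1 : v ∈ Metric.sphere (0 : EuclideanSpace ℝ (Fin m)) 1 := by
    simp [hv, norm_smul, hw0.ne']
  have hpsi : psiNorm P α (fun ω => inner ℝ (X ω) v) ≤ ENNReal.ofReal K :=
    le_trans (le_iSup₂ (f := fun x (_ : x ∈ Metric.sphere (0 : EuclideanSpace ℝ (Fin m)) 1) =>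
      psiNorm P α (fun ω => inner ℝ (X ω) x)) v hv1) h
  have hmain := integral_even_pow_le_of_psiNorm_le hα (hX.inner_const v) hK hpsi k
  have hwv : w = ‖w‖ • v := by rw [hv, smul_smul, mul_inv_cancel₀ hw0.ne', one_smul]
  have heq : ∫ ω, (inner ℝ (X ω) w : ℝ) ^ (2 * k) ∂P =
      ‖w‖ ^ (2 * k) * ∫ ω, (inner ℝ (X ω) v : ℝ) ^ (2 * k) ∂P := by
    rw [← integral_const_mul]
    congr 1; ext ω
    conv_lhs => rw [hwv, real_inner_smul_right, mul_pow]
  rw [heq]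
  calc _ = ‖w‖ ^ (2 * k) * (4 ^ k * ∫ ω, (inner ℝ (X ω) v : ℝ) ^ (2 * k) ∂P) := by ring
    _ ≤ ‖w‖ ^ (2 * k) * (momentWeight (1 / α - 1 / 2) k *
        (32 * (α ^ (-1 / α)) ^ 2 * K ^ 2) ^ k) := by gcongr
    _ = _ := by rw [pow_mul ‖w‖, mul_pow _ (‖w‖ ^ 2)]; ring

end Psi

/-! ### `L_p` norms of bounded functions -/

section LpNorm

variable {Ω : Type*} [MeasurableSpace Ω] {P : Measure Ω}
  {E : Type*} [NormedAddCommGroup E]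

lemma lpNorm_pow_eq_integral {f : Ω → E} (hf : MemLp f ∞ P) {p : ℕ} (hp : p ≠ 0) :
    lpNorm f (p : ℝ≥0∞) P ^ p = ∫ ω, ‖f ω‖ ^ p ∂P := by
  rw [lpNorm_eq_integral_norm_rpow_toReal (by simpa using hp) (by simp) hf.1, ← Real.rpow_natCast,
    ← Real.rpow_mul (by positivity)]
  simp [hp]

lemma lpNorm_le_of_integral_pow_le {f : Ω → E} (hf : MemLp f ∞ P) {p : ℕ} (hp : p ≠ 0) {c : ℝ}
    (hc : 0 ≤ c) (h : ∫ ω, ‖f ω‖ ^ p ∂P ≤ c ^ p) : lpNorm f (p : ℝ≥0∞) P ≤ c := by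
  rw [← lpNorm_pow_eq_integral hf hp] at h
  exact le_of_pow_le_pow_left₀ hp hc h

lemma lpNorm_norm_sq {f : Ω → E} (hf : MemLp f ∞ P) {p : ℕ} (hp : p ≠ 0) :
    lpNorm (fun ω => ‖f ω‖ ^ 2) (p : ℝ≥0∞) P = lpNorm f ((2 * p : ℕ) : ℝ≥0∞) P ^ 2 := by
  rw [← pow_left_inj₀ lpNorm_nonneg (by positivity) hp,
    lpNorm_pow_eq_integral (memLp_top_pow hf.norm 2) hp, ← pow_mul,
    lpNorm_pow_eq_integral hf (by omega)]
  simp [← pow_mul]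

variable [IsProbabilityMeasure P]

lemma MeasureTheory.MemLp.of_top {f : Ω → E} (hf : MemLp f ∞ P) (p : ℝ≥0∞) : MemLp f p P :=
  hf.mono_exponent le_top

lemma lpNorm_mono_exponent {f : Ω → E} (hf : MemLp f ∞ P) {p q : ℝ≥0∞} (h : p ≤ q) :
    lpNorm f p P ≤ lpNorm f q P := by
  rw [← toReal_eLpNorm hf.1, ← toReal_eLpNorm hf.1]
  exact ENNReal.toReal_mono (hf.of_top q).2.ne (eLpNorm_le_eLpNorm_of_exponent_le h hf.1)

lemma lpNorm_mono_ae {F : Type*} [NormedAddCommGroup F] {f : Ω → E} {g : Ω → F}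
    (hf : MemLp f ∞ P) (hg : MemLp g ∞ P)
    (p : ℝ≥0∞) (h : ∀ᵐ ω ∂P, ‖f ω‖ ≤ ‖g ω‖) : lpNorm f p P ≤ lpNorm g p P := by
  rw [← toReal_eLpNorm hf.1, ← toReal_eLpNorm hg.1]
  exact ENNReal.toReal_mono (hg.of_top p).2.ne (eLpNorm_mono_ae h)

lemma lpNorm_mul_le {f g : Ω → ℝ} (hf : MemLp f ∞ P) (hg : MemLp g ∞ P) (p : ℕ) :
    lpNorm (fun ω => f ω * g ω) (p : ℝ≥0∞) P ≤
      lpNorm f ((2 * p : ℕ) : ℝ≥0∞) P * lpNorm g ((2 * p : ℕ) : ℝ≥0∞) P := by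
  have hfg : MemLp (fun ω => f ω * g ω) ∞ P := hg.mul' hf
  have hr : (((2 * p : ℕ) : ℝ≥0∞))⁻¹ + (((2 * p : ℕ) : ℝ≥0∞))⁻¹ = (p : ℝ≥0∞)⁻¹ := by
    have h2 : ((2 * p : ℕ) : ℝ≥0∞) = 2 * p := by push_cast; rfl
    rw [h2, ENNReal.mul_inv (by simp) (by simp), ← add_mul, ENNReal.inv_two_add_inv_two, one_mul]
  generalize ((2 * p : ℕ) : ℝ≥0∞) = s at hr ⊢
  have : ENNReal.HolderTriple s s (p : ℝ≥0∞) := ⟨hr⟩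
  rw [← toReal_eLpNorm hf.1, ← toReal_eLpNorm hg.1, ← toReal_eLpNorm hfg.1, ← ENNReal.toReal_mul]
  refine ENNReal.toReal_mono (ENNReal.mul_ne_top (hf.of_top _).2.ne (hg.of_top _).2.ne) ?_
  exact eLpNorm_smul_le_mul_eLpNorm (f := g) (φ := f) (p := s) (q := s) (r := (p : ℝ≥0∞)) hg.1 hf.1

end LpNorm

/-- Independent centred columns of constant norm `lam` whose one-dimensional marginals have the
moments of a `ψ_α` variable of scale `B`. -/
structure IsWeibullColumns {Ω : Type*} [MeasurableSpace Ω] (P : Measure Ω) (α B lam : ℝ)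
    {m n : ℕ} (a : Fin n → Ω → EuclideanSpace ℝ (Fin m)) : Prop where
  measurable : ∀ i, Measurable (a i)
  indep : iIndepFun a P
  mean : ∀ i, ∫ ω, a i ω ∂P = 0
  norm_eq : ∀ i, ∀ᵐ ω ∂P, ‖a i ω‖ = lam
  moment : ∀ i w k, 4 ^ k * ∫ ω, (inner ℝ (a i ω) w : ℝ) ^ (2 * k) ∂P ≤
    momentWeight (1 / α - 1 / 2) k * (B ^ 2 * ‖w‖ ^ 2) ^ k

/-- The linear combination of the columns `a i`, `i ∈ I`, with coefficients `u i`. -/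
noncomputable def colComb {Ω : Type*} {m n : ℕ} (a : Fin n → Ω → EuclideanSpace ℝ (Fin m))
    (I : Finset (Fin n)) (u : EuclideanSpace ℝ (Fin n)) (ω : Ω) : EuclideanSpace ℝ (Fin m) :=
  ∑ i ∈ I, u i • a i ω

/-- The off-diagonal part of the bilinear form `⟨A u, A v⟩`. -/
noncomputable def colChaos {Ω : Type*} {m n : ℕ} (a : Fin n → Ω → EuclideanSpace ℝ (Fin m))
    (lam : ℝ) (u v : EuclideanSpace ℝ (Fin n)) (ω : Ω) : ℝ :=
  inner ℝ (colComb a Finset.univ u ω) (colComb a Finset.univ v ω) - lam ^ 2 * inner ℝ u v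

/-! ### Decoupling by random subsets -/

section Decoupling

/-- For `i ≠ j`, exactly a quarter of all subsets contain `i` and miss `j`. -/
lemma four_mul_sum_powerset_sum {n : ℕ} (f : Fin n → Fin n → ℝ) :
    4 * ∑ I : Finset (Fin n), ∑ i ∈ I, ∑ j ∈ Iᶜ, f i j =
      2 ^ n * ∑ i, ∑ j ∈ Finset.univ.erase i, f i j := by
  have h1 : ∀ I : Finset (Fin n), ∑ i ∈ I, ∑ j ∈ Iᶜ, f i j =
      ∑ i, ∑ j, if i ∈ I ∧ j ∉ I then f i j else 0 := by
    intro I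
    simp [ite_and, Finset.sum_ite_mem, Finset.sum_ite, Finset.filter_notMem_eq_sdiff,
      Finset.compl_eq_univ_sdiff]
  have h2 : ∀ i j : Fin n, 4 * ∑ I : Finset (Fin n), (if i ∈ I ∧ j ∉ I then f i j else 0) =
      if i ≠ j then 2 ^ n * f i j else 0 := by
    intro i j
    rw [← Finset.sum_filter, Finset.sum_const, nsmul_eq_mul]
    by_cases hij : i = j
    · subst hij; simp
    · have hfil : Finset.univ.filter (fun I : Finset (Fin n) => i ∈ I ∧ j ∉ I) =
          Finset.Icc {i} {j}ᶜ := by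
        ext I
        simp
      rw [hfil, Finset.card_Icc_finset (by simpa using Ne.symm hij)]
      have hn : 2 ≤ n := by
        have := i.2; have := j.2
        by_contra hlt
        exact hij (Fin.ext (by omega))
      obtain ⟨k, rfl⟩ := Nat.exists_eq_add_of_le hn
      simp [Finset.card_compl, hij, pow_add]
      ring_nf
  calc 4 * ∑ I : Finset (Fin n), ∑ i ∈ I, ∑ j ∈ Iᶜ, f i j
      = ∑ i, ∑ j, 4 * ∑ I : Finset (Fin n), (if i ∈ I ∧ j ∉ I then f i j else 0) := by
        simp only [h1, Finset.mul_sum]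
        rw [Finset.sum_comm]
        refine Finset.sum_congr rfl fun i _ => ?_
        rw [Finset.sum_comm]
    _ = _ := by
        simp only [h2, Finset.mul_sum]
        refine Finset.sum_congr rfl fun i _ => ?_
        rw [← Finset.sum_filter]
        congr 1
        ext j
        simp [eq_comm]

end Decoupling

/-! ### Moments of the decoupled forms -/

section Columns

variable {Ω : Type*} [MeasurableSpace Ω] {P : Measure Ω}
  {m n : ℕ} {a : Fin n → Ω → EuclideanSpace ℝ (Fin m)} {α B lam : ℝ}

lemma IsWeibullColumns.indepFun_colComb (h : IsWeibullColumns P α B lam a) (I : Finset (Fin n))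
    (u v : EuclideanSpace ℝ (Fin n)) : IndepFun (colComb a I u) (colComb a Iᶜ v) P := by
  have hI := h.indep.indepFun_finset I Iᶜ disjoint_compl_right h.measurable
  have := hI.comp (φ := fun x : (i : I) → EuclideanSpace ℝ (Fin m) => ∑ i : I, u i • x i)
    (ψ := fun x : (i : ↥Iᶜ) → EuclideanSpace ℝ (Fin m) => ∑ i : ↥Iᶜ, v i • x i)
    (by fun_prop) (by fun_prop)
  convert this using 1
  · ext1 ω
    simp only [colComb, Function.comp]
    exact (Finset.sum_coe_sort I fun i => u i • a i ω).symm
  · ext1 ω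
    simp only [colComb, Function.comp]
    exact (Finset.sum_coe_sort Iᶜ fun i => v i • a i ω).symm

lemma IsWeibullColumns.measurable_colComb (h : IsWeibullColumns P α B lam a) (I : Finset (Fin n))
    (u : EuclideanSpace ℝ (Fin n)) : Measurable (colComb a I u) :=
  Finset.measurable_sum I fun i _ => (h.measurable i).const_smul (u i)

lemma IsWeibullColumns.memLp (h : IsWeibullColumns P α B lam a) (i : Fin n) :
    MemLp (a i) ∞ P :=
  memLp_top_of_bound (h.measurable i).aestronglyMeasurable lam
    ((h.norm_eq i).mono fun _ h => h.le)

lemma IsWeibullColumns.memLp_colComb (h : IsWeibullColumns P α B lam a) (I : Finset (Fin n))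
    (u : EuclideanSpace ℝ (Fin n)) : MemLp (colComb a I u) ∞ P :=
  memLp_finsetSum I fun i _ => (h.memLp i).const_smul (u i)

lemma MeasureTheory.MemLp.inner_top {f g : Ω → EuclideanSpace ℝ (Fin m)} (hf : MemLp f ∞ P)
    (hg : MemLp g ∞ P) : MemLp (fun ω => (inner ℝ (f ω) (g ω) : ℝ)) ∞ P := by
  have hfg : MemLp (fun ω => ‖f ω‖ * ‖g ω‖) ∞ P := hg.norm.mul' hf.norm
  exact hfg.mono (hf.1.inner hg.1) (Filter.Eventually.of_forall fun ω => by
    simpa using norm_inner_le_norm (𝕜 := ℝ) (f ω) (g ω))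

variable [IsProbabilityMeasure P]

lemma IsWeibullColumns.integral_inner_colComb_le (h : IsWeibullColumns P α B lam a)
    (hα : 0 < α) (hα2 : α ≤ 2) (I : Finset (Fin n)) (u : EuclideanSpace ℝ (Fin n))
    (w : EuclideanSpace ℝ (Fin m)) {q : ℕ} (hq : 1 ≤ q) :
    ∫ ω, (inner ℝ (colComb a I u ω) w : ℝ) ^ (2 * q) ∂P ≤
      (((2 * q : ℕ) : ℝ) ^ (1 / α) * B * ‖u‖ * ‖w‖) ^ (2 * q) := by
  have hβ : 0 ≤ 1 / α - 1 / 2 := by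
    have := one_div_le_one_div_of_le hα hα2; linarith
  have hmain := integral_even_pow_sum_le (P := P) (ξ := fun i ω => u i * (inner ℝ (a i ω) w : ℝ))
    (τ := fun i => u i ^ 2 * (B ^ 2 * ‖w‖ ^ 2)) hβ
    (fun i => ((h.memLp i).inner_const w).const_mul (u i))
    (h.indep.comp (fun i x => u i * (inner ℝ x w : ℝ)) fun i => by fun_prop)
    (fun i => by
      rw [integral_const_mul]
      have : ∫ ω, (inner ℝ (a i ω) w : ℝ) ∂P = 0 := by
        simp_rw [real_inner_comm w]
        rw [integral_inner ((h.memLp i).integrable le_top), h.mean i, inner_zero_right]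
      rw [this, mul_zero])
    (fun i => by positivity)
    (fun i k => by
      have := h.moment i w k
      simp only [mul_pow (u i)]
      rw [integral_const_mul, pow_mul (u i)]
      calc _ = (u i ^ 2) ^ k * (4 ^ k * ∫ ω, (inner ℝ (a i ω) w : ℝ) ^ (2 * k) ∂P) := by ring
        _ ≤ (u i ^ 2) ^ k * (momentWeight (1 / α - 1 / 2) k * (B ^ 2 * ‖w‖ ^ 2) ^ k) := by gcongr
        _ = _ := by rw [mul_pow]; ring) I q
  have hu : ∑ i ∈ I, u i ^ 2 * (B ^ 2 * ‖w‖ ^ 2) ≤ (B * ‖u‖ * ‖w‖) ^ 2 := by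
    rw [← Finset.sum_mul]
    have : ∑ i ∈ I, u i ^ 2 ≤ ‖u‖ ^ 2 := by
      rw [EuclideanSpace.real_norm_sq_eq]
      exact Finset.sum_le_sum_of_subset_of_nonneg (Finset.subset_univ I) fun i _ _ => sq_nonneg _
    calc _ ≤ ‖u‖ ^ 2 * (B ^ 2 * ‖w‖ ^ 2) := by gcongr
      _ = _ := by ring
  calc ∫ ω, (inner ℝ (colComb a I u ω) w : ℝ) ^ (2 * q) ∂P
      = ∫ ω, (∑ i ∈ I, u i * (inner ℝ (a i ω) w : ℝ)) ^ (2 * q) ∂P := by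
        simp only [colComb, sum_inner, real_inner_smul_left]
    _ ≤ _ := hmain
    _ ≤ (((2 * q : ℕ) : ℝ) ^ (1 / α)) ^ (2 * q) * ((B * ‖u‖ * ‖w‖) ^ 2) ^ q := by
        have := Finset.sum_nonneg (s := I) (f := fun i => u i ^ 2 * (B ^ 2 * ‖w‖ ^ 2))
          fun i _ => by positivity
        gcongr
        exact momentWeight_le hα hα2 hq
    _ = _ := by rw [← pow_mul, ← mul_pow]; ring

/-- Fubini: the columns outside `I` are frozen, and the fixed-direction bound
`integral_inner_colComb_le` applies to each value `w` of the second factor. -/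
lemma IsWeibullColumns.integral_inner_decoupled_le (h : IsWeibullColumns P α B lam a)
    (hα : 0 < α) (hα2 : α ≤ 2) (I : Finset (Fin n)) (u v : EuclideanSpace ℝ (Fin n))
    {q : ℕ} (hq : 1 ≤ q) :
    ∫ ω, (inner ℝ (colComb a I u ω) (colComb a Iᶜ v ω) : ℝ) ^ (2 * q) ∂P ≤
      (((2 * q : ℕ) : ℝ) ^ (1 / α) * B * ‖u‖) ^ (2 * q) *
        ∫ ω, ‖colComb a Iᶜ v ω‖ ^ (2 * q) ∂P := by
  set X := colComb a I u
  set W := colComb a Iᶜ v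
  have hX : Measurable X := h.measurable_colComb I u
  have hW : Measurable W := h.measurable_colComb Iᶜ v
  have hmap := (indepFun_iff_map_prod_eq_prod_map_map hX.aemeasurable hW.aemeasurable).1
    (h.indepFun_colComb I u v)
  have : IsProbabilityMeasure (P.map X) := Measure.isProbabilityMeasure_map hX.aemeasurable
  have : IsProbabilityMeasure (P.map W) := Measure.isProbabilityMeasure_map hW.aemeasurable
  have hfm : Measurable (fun z : EuclideanSpace ℝ (Fin m) × EuclideanSpace ℝ (Fin m) =>
      (inner ℝ z.1 z.2 : ℝ) ^ (2 * q)) := by fun_prop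
  have hint : Integrable (fun z : EuclideanSpace ℝ (Fin m) × EuclideanSpace ℝ (Fin m) =>
      (inner ℝ z.1 z.2 : ℝ) ^ (2 * q)) ((P.map X).prod (P.map W)) := by
    rw [← hmap, integrable_map_measure hfm.aestronglyMeasurable (hX.prodMk hW).aemeasurable]
    exact (memLp_top_pow ((h.memLp_colComb I u).inner_top (h.memLp_colComb Iᶜ v)) _).integrable
      le_top
  calc ∫ ω, (inner ℝ (X ω) (W ω) : ℝ) ^ (2 * q) ∂P
      = ∫ z, (inner ℝ z.1 z.2 : ℝ) ^ (2 * q) ∂(P.map fun ω => (X ω, W ω)) := by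
        rw [integral_map (hX.prodMk hW).aemeasurable hfm.aestronglyMeasurable]
    _ = ∫ w, ∫ x, (inner ℝ x w : ℝ) ^ (2 * q) ∂(P.map X) ∂(P.map W) := by
        rw [hmap, integral_prod_symm _ hint]
    _ ≤ ∫ w, (((2 * q : ℕ) : ℝ) ^ (1 / α) * B * ‖u‖) ^ (2 * q) * ‖w‖ ^ (2 * q) ∂(P.map W) := by
        refine integral_mono hint.integral_prod_right ?_ fun w => ?_
        · refine Integrable.const_mul ?_ _
          rw [integrable_map_measure (by fun_prop) hW.aemeasurable]
          exact (memLp_top_pow (h.memLp_colComb Iᶜ v).norm _).integrable le_top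
        · simp only
          rw [integral_map hX.aemeasurable (by fun_prop), ← mul_pow]
          exact h.integral_inner_colComb_le hα hα2 I u w hq
    _ = _ := by
        rw [integral_const_mul, integral_map hW.aemeasurable (by fun_prop)]

lemma IsWeibullColumns.lpNorm_inner_decoupled_le (h : IsWeibullColumns P α B lam a)
    (hα : 0 < α) (hα2 : α ≤ 2) (hB : 0 ≤ B) (I : Finset (Fin n))
    (u v : EuclideanSpace ℝ (Fin n)) {q : ℕ} (hq : 1 ≤ q) :
    lpNorm (fun ω => (inner ℝ (colComb a I u ω) (colComb a Iᶜ v ω) : ℝ)) ((2 * q : ℕ) : ℝ≥0∞) P ≤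
      ((2 * q : ℕ) : ℝ) ^ (1 / α) * B * ‖u‖ *
        lpNorm (colComb a Iᶜ v) ((2 * q : ℕ) : ℝ≥0∞) P := by
  refine lpNorm_le_of_integral_pow_le ((h.memLp_colComb I u).inner_top (h.memLp_colComb Iᶜ v))
    (by omega) (mul_nonneg (by positivity) lpNorm_nonneg) ?_
  rw [mul_pow, lpNorm_pow_eq_integral (h.memLp_colComb Iᶜ v) (by omega)]
  simp only [Real.norm_eq_abs, Even.pow_abs (even_two_mul q)]
  exact h.integral_inner_decoupled_le hα hα2 I u v hq

end Columns

/-- The image `A x` of a vector under the matrix with columns `a i`. -/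
noncomputable abbrev colMap {Ω : Type*} {m n : ℕ} (a : Fin n → Ω → EuclideanSpace ℝ (Fin m))
    (x : EuclideanSpace ℝ (Fin n)) (ω : Ω) : EuclideanSpace ℝ (Fin m) :=
  colComb a Finset.univ x ω

/-- The deviation `‖A x‖ - lam ‖x‖`. -/
noncomputable def colDeviation {Ω : Type*} {m n : ℕ}
    (a : Fin n → Ω → EuclideanSpace ℝ (Fin m)) (lam : ℝ) (x : EuclideanSpace ℝ (Fin n)) (ω : Ω) :
    ℝ :=
  ‖colMap a x ω‖ - lam * ‖x‖

lemma colMap_sub {Ω : Type*} {m n : ℕ} (a : Fin n → Ω → EuclideanSpace ℝ (Fin m))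
    (x y : EuclideanSpace ℝ (Fin n)) (ω : Ω) :
    colMap a (x - y) ω = colMap a x ω - colMap a y ω := by
  simp [colComb, sub_smul]

lemma colMap_add {Ω : Type*} {m n : ℕ} (a : Fin n → Ω → EuclideanSpace ℝ (Fin m))
    (x y : EuclideanSpace ℝ (Fin n)) (ω : Ω) :
    colMap a (x + y) ω = colMap a x ω + colMap a y ω := by
  simp [colComb, add_smul, Finset.sum_add_distrib]

/-! ### The off-diagonal form, norms of images and increments -/

section Chaos

variable {Ω : Type*} [MeasurableSpace Ω] {P : Measure Ω}
  {m n : ℕ} {a : Fin n → Ω → EuclideanSpace ℝ (Fin m)} {α B lam : ℝ}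

lemma IsWeibullColumns.memLp_colChaos (h : IsWeibullColumns P α B lam a)
    (u v : EuclideanSpace ℝ (Fin n)) : MemLp (colChaos a lam u v) ∞ P :=
  ((h.memLp_colComb _ u).inner_top (h.memLp_colComb _ v)).sub (memLp_top_const _)

lemma IsWeibullColumns.memLp_colDeviation (h : IsWeibullColumns P α B lam a)
    (x : EuclideanSpace ℝ (Fin n)) : MemLp (colDeviation a lam x) ∞ P :=
  (h.memLp_colComb _ x).norm.sub (memLp_top_const _)

/-- The essential use of constant column norms: the diagonal of `⟨Au, Av⟩` equals `λ²⟨u, v⟩` almost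
surely, so only off-diagonal terms remain to be decoupled. -/
lemma IsWeibullColumns.colChaos_ae_eq (h : IsWeibullColumns P α B lam a)
    (u v : EuclideanSpace ℝ (Fin n)) : ∀ᵐ ω ∂P, colChaos a lam u v ω =
      4 / 2 ^ n * ∑ I : Finset (Fin n), (inner ℝ (colComb a I u ω) (colComb a Iᶜ v ω) : ℝ) := by
  filter_upwards [ae_all_iff.2 h.norm_eq] with ω hω
  have h1 := four_mul_sum_powerset_sum fun i j =>
    u i * (v j * (inner ℝ (a i ω) (a j ω) : ℝ))
  have h2 : ∀ I J : Finset (Fin n), (inner ℝ (colComb a I u ω) (colComb a J v ω) : ℝ) =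
      ∑ i ∈ I, ∑ j ∈ J, u i * (v j * (inner ℝ (a i ω) (a j ω) : ℝ)) := by
    intro I J
    rw [colComb, sum_inner]
    refine Finset.sum_congr rfl fun i _ => ?_
    rw [colComb, inner_sum]
    simp only [real_inner_smul_left, real_inner_smul_right]
    exact Finset.sum_congr rfl fun j _ => by ring
  have h3 : colChaos a lam u v ω = ∑ i, ∑ j ∈ Finset.univ.erase i,
      u i * (v j * (inner ℝ (a i ω) (a j ω) : ℝ)) := by
    rw [colChaos, h2, PiLp.inner_apply, Finset.mul_sum, ← Finset.sum_sub_distrib]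
    refine Finset.sum_congr rfl fun i _ => ?_
    rw [← Finset.add_sum_erase _ _ (Finset.mem_univ i), real_inner_self_eq_norm_sq, hω i]
    simp
    ring
  rw [h3]
  simp only [h2]
  rw [div_mul_eq_mul_div, h1]
  field_simp

variable [IsProbabilityMeasure P]

/-- The best constant in `‖‖A x‖‖_p ≤ M ‖x‖`. -/
lemma IsWeibullColumns.exists_best_constant (h : IsWeibullColumns P α B lam a) {p : ℝ≥0∞}
    (hp : 1 ≤ p) :
    ∃ M : ℝ, 0 ≤ M ∧ (∀ x, lpNorm (colMap a x) p P ≤ M * ‖x‖) ∧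
      ∀ c : ℝ, 0 ≤ c → (∀ x, lpNorm (colMap a x) p P ≤ c * ‖x‖) → M ≤ c := by
  set s : Set ℝ := {c | 0 ≤ c ∧ ∀ x, lpNorm (colMap a x) p P ≤ c * ‖x‖} with hs
  have hne : s.Nonempty := by
    refine ⟨∑ i, lpNorm (a i) p P, Finset.sum_nonneg fun i _ => lpNorm_nonneg, fun x => ?_⟩
    have h1 : lpNorm (colMap a x) p P ≤ ∑ i, lpNorm (x i • a i) p P := by
      have := lpNorm_sum_le (p := p) (μ := P) (s := Finset.univ) (f := fun i => x i • a i)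
        (fun i _ => ((h.memLp i).of_top p).const_smul (x i)) hp
      convert this using 2
      ext1 ω; simp [colComb]
    refine h1.trans ?_
    rw [Finset.sum_mul]
    refine Finset.sum_le_sum fun i _ => ?_
    rw [lpNorm_const_smul, mul_comm]
    have : ‖x i‖ ≤ ‖x‖ := PiLp.norm_apply_le x i
    exact mul_le_mul_of_nonneg_left (by simpa using this) lpNorm_nonneg
  have hbdd : BddBelow s := ⟨0, fun c hc => hc.1⟩
  refine ⟨sInf s, Real.sInf_nonneg fun c hc => hc.1, fun x => ?_, fun c hc hx =>
    csInf_le hbdd ⟨hc, hx⟩⟩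
  rcases eq_or_lt_of_le (norm_nonneg x) with hx | hx
  · obtain ⟨c, hc⟩ := hne
    have := hc.2 x
    rwa [← hx, mul_zero] at this ⊢
  · rw [← div_le_iff₀ hx]
    exact le_csInf hne fun c hc => (div_le_iff₀ hx).2 (hc.2 x)

lemma IsWeibullColumns.lpNorm_colChaos_le (h : IsWeibullColumns P α B lam a)
    (hα : 0 < α) (hα2 : α ≤ 2) (hB : 0 ≤ B) {q : ℕ} (hq : 1 ≤ q) {M : ℝ} (hM0 : 0 ≤ M)
    (hM : ∀ x, lpNorm (colMap a x) ((2 * q : ℕ) : ℝ≥0∞) P ≤ M * ‖x‖)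
    (u v : EuclideanSpace ℝ (Fin n)) :
    lpNorm (colChaos a lam u v) ((2 * q : ℕ) : ℝ≥0∞) P ≤
      4 * (((2 * q : ℕ) : ℝ) ^ (1 / α) * B) * M * (‖u‖ * ‖v‖) := by
  have hp1 : (1 : ℝ≥0∞) ≤ ((2 * q : ℕ) : ℝ≥0∞) := by exact_mod_cast (by omega : 1 ≤ 2 * q)
  set N := ((2 * q : ℕ) : ℝ) ^ (1 / α)
  have hN : 0 ≤ N := by positivity
  have hT : ∀ I : Finset (Fin n),
      MemLp (fun ω => (inner ℝ (colComb a I u ω) (colComb a Iᶜ v ω) : ℝ)) ∞ P := fun I =>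
    (h.memLp_colComb I u).inner_top (h.memLp_colComb Iᶜ v)
  -- A partial combination is the image of `v` with coordinates outside `I` set to zero, so the same
  -- `M` serves every `I`.
  have hrestr : ∀ I : Finset (Fin n), lpNorm (colComb a I v) ((2 * q : ℕ) : ℝ≥0∞) P ≤
      M * ‖v‖ := by
    intro I
    set v' : EuclideanSpace ℝ (Fin n) := WithLp.toLp 2 fun i => if i ∈ I then v i else 0
    have h1 : colComb a I v = colMap a v' := by
      ext1 ω
      simp [colComb, v', ite_smul, Finset.sum_ite_mem]
    have h2 : ‖v'‖ ≤ ‖v‖ := by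
      rw [EuclideanSpace.norm_eq, EuclideanSpace.norm_eq]
      refine Real.sqrt_le_sqrt (Finset.sum_le_sum fun i _ => ?_)
      by_cases hi : i ∈ I
      · simp [v', hi]
      · simp only [v', hi, if_false]; simp; positivity
    rw [h1]
    exact (hM v').trans (by gcongr)
  have hsum : MemLp (fun ω => ∑ I : Finset (Fin n),
      (inner ℝ (colComb a I u ω) (colComb a Iᶜ v ω) : ℝ)) ∞ P :=
    memLp_finsetSum _ fun I _ => hT I
  calc lpNorm (colChaos a lam u v) ((2 * q : ℕ) : ℝ≥0∞) P
      ≤ lpNorm ((4 / 2 ^ n : ℝ) • fun ω => ∑ I : Finset (Fin n),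
          (inner ℝ (colComb a I u ω) (colComb a Iᶜ v ω) : ℝ)) ((2 * q : ℕ) : ℝ≥0∞) P := by
        refine lpNorm_mono_ae (h.memLp_colChaos u v) (hsum.const_smul _) _ ?_
        filter_upwards [h.colChaos_ae_eq u v] with ω hω
        rw [hω]; simp
    _ ≤ 4 / 2 ^ n * ∑ I : Finset (Fin n), lpNorm (fun ω =>
          (inner ℝ (colComb a I u ω) (colComb a Iᶜ v ω) : ℝ)) ((2 * q : ℕ) : ℝ≥0∞) P := by
        rw [lpNorm_const_smul]
        have := lpNorm_sum_le (p := ((2 * q : ℕ) : ℝ≥0∞)) (μ := P)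
          (s := (Finset.univ : Finset (Finset (Fin n))))
          (f := fun I ω => (inner ℝ (colComb a I u ω) (colComb a Iᶜ v ω) : ℝ))
          (fun I _ => (hT I).of_top _) hp1
        have h4 : ((‖(4 / 2 ^ n : ℝ)‖₊ : ℝ≥0) : ℝ) = 4 / 2 ^ n := by
          rw [coe_nnnorm, Real.norm_of_nonneg (by positivity)]
        rw [h4]
        refine mul_le_mul_of_nonneg_left (le_trans (le_of_eq ?_) this) (by positivity)
        congr 1; ext1 ω; simp
    _ ≤ 4 / 2 ^ n * ∑ _I : Finset (Fin n), N * B * ‖u‖ * (M * ‖v‖) := by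
        gcongr with I
        exact (h.lpNorm_inner_decoupled_le hα hα2 hB I u v hq).trans (by
          gcongr; exact hrestr Iᶜ)
    _ = _ := by
        simp only [Finset.sum_const, Finset.card_univ, Fintype.card_finset, Fintype.card_fin,
          nsmul_eq_mul]
        push_cast
        field_simp

/-- `L_p` bound for the norm of `A x`. -/
lemma IsWeibullColumns.lpNorm_colMap_le (h : IsWeibullColumns P α B lam a)
    (hα : 0 < α) (hα2 : α ≤ 2) (hB : 0 ≤ B) (hlam : 0 ≤ lam) {q : ℕ} (hq : 1 ≤ q)
    (x : EuclideanSpace ℝ (Fin n)) :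
    lpNorm (colMap a x) ((2 * q : ℕ) : ℝ≥0∞) P ≤
      (lam + 4 * (((2 * q : ℕ) : ℝ) ^ (1 / α) * B)) * ‖x‖ := by
  have hp1 : (1 : ℝ≥0∞) ≤ ((2 * q : ℕ) : ℝ≥0∞) := by exact_mod_cast (by omega : 1 ≤ 2 * q)
  obtain ⟨M, hM0, hM, hbest⟩ := h.exists_best_constant hp1
  have hch := h.lpNorm_colChaos_le hα hα2 hB hq hM0 hM
  set D := ((2 * q : ℕ) : ℝ) ^ (1 / α) * B
  have hD : 0 ≤ D := by positivity
  -- Self-bounding: the chaos bound with constant `M` shows that this square root is also a valid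
  -- constant, so minimality of `M` gives a quadratic inequality.
  have hMle : M ≤ √(lam ^ 2 + 4 * D * M) := by
    refine hbest _ (by positivity) fun y => ?_
    have hy := h.memLp_colComb Finset.univ y
    have hsq : lpNorm (colMap a y) ((2 * q : ℕ) : ℝ≥0∞) P ^ 2 ≤
        (lam ^ 2 + 4 * D * M) * ‖y‖ ^ 2 := by
      calc lpNorm (colMap a y) ((2 * q : ℕ) : ℝ≥0∞) P ^ 2
          ≤ lpNorm (colMap a y) ((2 * (2 * q) : ℕ) : ℝ≥0∞) P ^ 2 := by
            refine pow_le_pow_left₀ lpNorm_nonneg (lpNorm_mono_exponent hy ?_) 2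
            exact_mod_cast (by omega : 2 * q ≤ 2 * (2 * q))
        _ = lpNorm (colChaos a lam y y + fun _ => lam ^ 2 * ‖y‖ ^ 2) ((2 * q : ℕ) : ℝ≥0∞) P := by
            rw [← lpNorm_norm_sq hy (by omega)]
            congr 1; ext1 ω
            simp [colChaos]
        _ ≤ 4 * D * M * (‖y‖ * ‖y‖) + lam ^ 2 * ‖y‖ ^ 2 := by
            refine (lpNorm_add_le ((h.memLp_colChaos y y).of_top _) hp1).trans ?_
            refine add_le_add (hch y y) (le_of_eq ?_)
            rw [lpNorm_const (by positivity) (IsProbabilityMeasure.ne_zero P)]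
            simp
        _ = _ := by ring
    rw [← Real.sqrt_sq (norm_nonneg y), ← Real.sqrt_mul (by positivity)]
    exact Real.le_sqrt_of_sq_le hsq
  have hM2 : M ^ 2 ≤ lam ^ 2 + 4 * D * M := by
    have := pow_le_pow_left₀ hM0 hMle 2
    rwa [Real.sq_sqrt (by positivity)] at this
  have : M ≤ lam + 4 * D := by
    by_contra hlt
    push Not at hlt
    nlinarith [mul_nonneg hD hM0, mul_nonneg hD hlam]
  exact (hM x).trans (by gcongr)

lemma IsWeibullColumns.lpNorm_colChaos_le' (h : IsWeibullColumns P α B lam a)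
    (hα : 0 < α) (hα2 : α ≤ 2) (hB : 0 ≤ B) (hlam : 0 ≤ lam) {q : ℕ} (hq : 1 ≤ q)
    (u v : EuclideanSpace ℝ (Fin n)) :
    lpNorm (colChaos a lam u v) ((2 * q : ℕ) : ℝ≥0∞) P ≤
      4 * (((2 * q : ℕ) : ℝ) ^ (1 / α) * B) * (lam + 4 * (((2 * q : ℕ) : ℝ) ^ (1 / α) * B)) *
        (‖u‖ * ‖v‖) :=
  h.lpNorm_colChaos_le hα hα2 hB hq (by positivity)
    (fun x => h.lpNorm_colMap_le hα hα2 hB hlam hq x) u v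

/-- One-point moments: `‖‖A x‖ - lam ‖x‖‖_p ≲ p ^ (1 / α) B ‖x‖`. -/
lemma IsWeibullColumns.lpNorm_colDeviation_le (h : IsWeibullColumns P α B lam a)
    (hα : 0 < α) (hα2 : α ≤ 2) (hB : 0 ≤ B) (hlam : 0 < lam) {q : ℕ} (hq : 1 ≤ q)
    (x : EuclideanSpace ℝ (Fin n)) :
    lpNorm (colDeviation a lam x) ((2 * q : ℕ) : ℝ≥0∞) P ≤
      20 * (((2 * q : ℕ) : ℝ) ^ (1 / α) * B) * ‖x‖ := by
  have hp1 : (1 : ℝ≥0∞) ≤ ((2 * q : ℕ) : ℝ≥0∞) := by exact_mod_cast (by omega : 1 ≤ 2 * q)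
  have hch := h.lpNorm_colChaos_le' hα hα2 hB hlam.le hq x x
  have hmap := h.lpNorm_colMap_le hα hα2 hB hlam.le hq x
  set D := ((2 * q : ℕ) : ℝ) ^ (1 / α) * B
  have hD : 0 ≤ D := by positivity
  have hdev := h.memLp_colDeviation x
  rcases eq_or_lt_of_le (norm_nonneg x) with hx | hx
  · have hx0 : x = 0 := norm_eq_zero.1 hx.symm
    have : colDeviation a lam x = 0 := by
      ext1 ω; simp [colDeviation, colMap, colComb, hx0]
    rw [this]; simp; positivity
  -- For `D ≤ λ`, divide the chaos by `‖Ax‖ + λ‖x‖ ≥ λ‖x‖`, with constant `4 · 5 = 20`. For `D > λ`,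
  -- the triangle inequality costs only `6D`.
  rcases le_or_gt D lam with hcase | hcase
  · have h1 : (lam * ‖x‖) * lpNorm (colDeviation a lam x) ((2 * q : ℕ) : ℝ≥0∞) P ≤
        lpNorm (colChaos a lam x x) ((2 * q : ℕ) : ℝ≥0∞) P := by
      have h2 := lpNorm_const_smul (lam * ‖x‖) (colDeviation a lam x) P
        (p := ((2 * q : ℕ) : ℝ≥0∞))
      rw [coe_nnnorm, Real.norm_of_nonneg (by positivity)] at h2
      rw [← h2]
      refine lpNorm_mono_ae (hdev.const_smul _) (h.memLp_colChaos x x) _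
        (Filter.Eventually.of_forall fun ω => ?_)
      have h3 : colChaos a lam x x ω =
          (‖colMap a x ω‖ + lam * ‖x‖) * colDeviation a lam x ω := by
        simp only [colChaos, colDeviation, real_inner_self_eq_norm_sq]; ring
      rw [h3, Pi.smul_apply, smul_eq_mul, norm_mul, norm_mul _ (colDeviation a lam x ω)]
      refine mul_le_mul_of_nonneg_right ?_ (norm_nonneg (colDeviation a lam x ω))
      rw [Real.norm_of_nonneg (by positivity), Real.norm_of_nonneg (by positivity)]
      linarith [norm_nonneg (colMap a x ω)]
    refine le_of_mul_le_mul_left (h1.trans (hch.trans ?_)) (by positivity : 0 < lam * ‖x‖)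
    calc 4 * D * (lam + 4 * D) * (‖x‖ * ‖x‖) ≤ 4 * D * (lam + 4 * lam) * (‖x‖ * ‖x‖) := by gcongr
      _ = _ := by ring
  · calc lpNorm (colDeviation a lam x) ((2 * q : ℕ) : ℝ≥0∞) P
        ≤ lpNorm (fun ω => ‖colMap a x ω‖) ((2 * q : ℕ) : ℝ≥0∞) P +
          lpNorm (fun _ : Ω => lam * ‖x‖) ((2 * q : ℕ) : ℝ≥0∞) P :=
          lpNorm_sub_le ((h.memLp_colComb _ x).norm.of_top _) hp1
      _ ≤ (lam + 4 * D) * ‖x‖ + lam * ‖x‖ := by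
          refine add_le_add ?_ (le_of_eq ?_)
          · rw [lpNorm_norm (h.memLp_colComb _ x).1]; exact hmap
          · rw [lpNorm_const (by positivity) (IsProbabilityMeasure.ne_zero P)]
            simp [abs_of_nonneg, hlam.le]
      _ ≤ (D + 4 * D) * ‖x‖ + D * ‖x‖ := by gcongr
      _ ≤ _ := by nlinarith [mul_nonneg hD hx.le]

/-- Increments: `‖Z_x - Z_y‖_p ≲ p ^ (1 / α) B ‖x - y‖` for `Z_x = ‖A x‖ - lam ‖x‖`. -/
lemma IsWeibullColumns.lpNorm_colDeviation_sub_le (h : IsWeibullColumns P α B lam a)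
    (hα : 0 < α) (hα2 : α ≤ 2) (hB : 0 ≤ B) (hlam : 0 < lam) {q : ℕ} (hq : 1 ≤ q)
    (x y : EuclideanSpace ℝ (Fin n)) :
    lpNorm (fun ω => colDeviation a lam x ω - colDeviation a lam y ω) ((2 * q : ℕ) : ℝ≥0∞) P ≤
      120 * 2 ^ (1 / α) * B * ((2 * q : ℕ) : ℝ) ^ (1 / α) * ‖x - y‖ := by
  have hp1 : (1 : ℝ≥0∞) ≤ ((2 * q : ℕ) : ℝ≥0∞) := by exact_mod_cast (by omega : 1 ≤ 2 * q)
  have hch := h.lpNorm_colChaos_le' hα hα2 hB hlam.le hq (x - y) (x + y)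
  have hmap := h.lpNorm_colMap_le hα hα2 hB hlam.le hq (x - y)
  have hmap2 := h.lpNorm_colMap_le hα hα2 hB hlam.le (show 1 ≤ 2 * q by omega) (x - y)
  have hdev2 := h.lpNorm_colDeviation_le hα hα2 hB hlam (show 1 ≤ 2 * q by omega)
  have hDD : (((2 * (2 * q) : ℕ) : ℝ)) ^ (1 / α) * B =
      2 ^ (1 / α) * (((2 * q : ℕ) : ℝ) ^ (1 / α) * B) := by
    rw [Nat.cast_mul, Real.mul_rpow (by positivity) (by positivity)]; simp [mul_assoc]
  rw [hDD] at hmap2 hdev2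
  have h2α : (1 : ℝ) ≤ 2 ^ (1 / α) := Real.one_le_rpow (by norm_num) (by positivity)
  rw [show 120 * 2 ^ (1 / α) * B * ((2 * q : ℕ) : ℝ) ^ (1 / α) * ‖x - y‖ =
    120 * (2 ^ (1 / α) * (((2 * q : ℕ) : ℝ) ^ (1 / α) * B)) * ‖x - y‖ by ring]
  set D := ((2 * q : ℕ) : ℝ) ^ (1 / α) * B
  set D' := 2 ^ (1 / α) * D
  have hD : 0 ≤ D := by positivity
  have hDD' : D ≤ D' := le_mul_of_one_le_left hD h2α
  have hD' : 0 ≤ D' := hD.trans hDD'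
  have hx := h.memLp_colDeviation x
  have hy := h.memLp_colDeviation y
  have hu := h.memLp_colComb Finset.univ (x - y)
  have hinc : MemLp (fun ω => colDeviation a lam x ω - colDeviation a lam y ω) ∞ P := hx.sub hy
  have hconst : ∀ c : ℝ, 0 ≤ c → lpNorm (fun _ : Ω => c) ((2 * q : ℕ) : ℝ≥0∞) P = c := by
    intro c hc
    rw [lpNorm_const (by positivity) (IsProbabilityMeasure.ne_zero P)]
    simp [abs_of_nonneg hc]
  -- The threshold is `D' = 2^(1/α) D`, the scale at the doubled exponent, because a product of two
  -- random factors will be split by Cauchy–Schwarz.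
  rcases le_or_gt D' lam with hcase | hcase
  · rcases eq_or_lt_of_le (add_nonneg (norm_nonneg x) (norm_nonneg y)) with hr | hr
    · have hx0 : x = 0 := norm_eq_zero.1 (by linarith [norm_nonneg x, norm_nonneg y])
      have hy0 : y = 0 := norm_eq_zero.1 (by linarith [norm_nonneg x, norm_nonneg y])
      subst hx0 hy0
      simp
    set r := ‖x‖ + ‖y‖ with hrdef
    set F : Ω → ℝ := fun ω => |colChaos a lam (x - y) (x + y) ω|
    set G : Ω → ℝ := fun ω => |colDeviation a lam x ω| + |colDeviation a lam y ω|
    have hF : MemLp F ∞ P := (h.memLp_colChaos _ _).norm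
    have hG : MemLp G ∞ P := hx.norm.add hy.norm
    have huG : MemLp (fun ω => ‖colMap a (x - y) ω‖ * G ω) ∞ P := hG.mul' hu.norm
    have h1 : (lam * r) * lpNorm (fun ω => colDeviation a lam x ω - colDeviation a lam y ω)
        ((2 * q : ℕ) : ℝ≥0∞) P ≤
        lpNorm (F + fun ω => ‖colMap a (x - y) ω‖ * G ω) ((2 * q : ℕ) : ℝ≥0∞) P := by
      have h2 := lpNorm_const_smul (lam * r)
        (fun ω => colDeviation a lam x ω - colDeviation a lam y ω) P (p := ((2 * q : ℕ) : ℝ≥0∞))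
      rw [coe_nnnorm, Real.norm_of_nonneg (by positivity)] at h2
      rw [← h2]
      refine lpNorm_mono_ae (hinc.const_smul _) (hF.add huG) _
        (Filter.Eventually.of_forall fun ω => ?_)
      -- The factorisation `‖Ax‖² - ‖Ay‖² = ⟨A(x-y), A(x+y)⟩` with `‖Ax‖ + ‖Ay‖ = λr + Z_x + Z_y`
      -- isolates the increment. The correction is a product of `‖A(x-y)‖` and one-point deviations,
      -- both already controlled.
      have hid : (lam * r) * (colDeviation a lam x ω - colDeviation a lam y ω) =
          colChaos a lam (x - y) (x + y) ω - (‖colMap a x ω‖ - ‖colMap a y ω‖) *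
            (colDeviation a lam x ω + colDeviation a lam y ω) := by
        have e1 : (inner ℝ (x - y) (x + y) : ℝ) = ‖x‖ ^ 2 - ‖y‖ ^ 2 := by
          rw [inner_sub_left, inner_add_right, inner_add_right, real_inner_self_eq_norm_sq,
            real_inner_self_eq_norm_sq, real_inner_comm x y]; ring
        have e2 : (inner ℝ (colMap a (x - y) ω) (colMap a (x + y) ω) : ℝ) =
            ‖colMap a x ω‖ ^ 2 - ‖colMap a y ω‖ ^ 2 := by
          rw [colMap_sub a, colMap_add a, inner_sub_left, inner_add_right, inner_add_right,
            real_inner_self_eq_norm_sq, real_inner_self_eq_norm_sq,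
            real_inner_comm (colMap a x ω) (colMap a y ω)]; ring
        rw [colChaos, e1]
        change _ = (inner ℝ (colMap a (x - y) ω) (colMap a (x + y) ω) : ℝ) - _ - _
        rw [e2]
        simp only [colDeviation, hrdef]; ring
      have hle : |‖colMap a x ω‖ - ‖colMap a y ω‖| ≤ ‖colMap a (x - y) ω‖ := by
        rw [colMap_sub a]; exact abs_norm_sub_norm_le _ _
      simp only [Pi.smul_apply, smul_eq_mul, hid, Pi.add_apply, Real.norm_eq_abs]
      rw [abs_of_nonneg (by positivity : 0 ≤ F ω + ‖colMap a (x - y) ω‖ * G ω)]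
      refine (abs_sub _ _).trans (add_le_add le_rfl ?_)
      rw [abs_mul]
      exact mul_le_mul hle (abs_add_le _ _) (abs_nonneg _) (norm_nonneg _)
    have h3 : lpNorm (fun ω => ‖colMap a (x - y) ω‖ * G ω) ((2 * q : ℕ) : ℝ≥0∞) P ≤
        ((lam + 4 * D') * ‖x - y‖) * (20 * D' * r) := by
      refine (lpNorm_mul_le hu.norm hG (2 * q)).trans ?_
      refine mul_le_mul ?_ ?_ lpNorm_nonneg (by positivity)
      · rw [lpNorm_norm hu.1]; exact hmap2
      · refine (lpNorm_add_le (hx.norm.of_top _)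
          (by exact_mod_cast (by omega : 1 ≤ 2 * (2 * q)))).trans ?_
        rw [hrdef, mul_add]
        refine add_le_add ?_ ?_
        · exact (lpNorm_norm hx.1 _).trans_le (hdev2 x)
        · exact (lpNorm_norm hy.1 _).trans_le (hdev2 y)
    have h4 : lpNorm F ((2 * q : ℕ) : ℝ≥0∞) P ≤ 4 * D * (lam + 4 * D) * (‖x - y‖ * r) := by
      refine ((lpNorm_norm (h.memLp_colChaos _ _).1 _).trans_le hch).trans ?_
      gcongr
      exact norm_add_le x y
    refine le_of_mul_le_mul_left (h1.trans ((lpNorm_add_le (hF.of_top _) hp1).trans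
      ((add_le_add h4 h3).trans ?_))) (by positivity : 0 < lam * r)
    -- The constant is `120 = 4 · 5 + 5 · 20`.
    calc 4 * D * (lam + 4 * D) * (‖x - y‖ * r) + ((lam + 4 * D') * ‖x - y‖) * (20 * D' * r)
        ≤ 4 * D' * (lam + 4 * lam) * (‖x - y‖ * r) +
          ((lam + 4 * lam) * ‖x - y‖) * (20 * D' * r) := by
          have := hDD'.trans hcase
          gcongr
      _ = _ := by ring
  · calc lpNorm (fun ω => colDeviation a lam x ω - colDeviation a lam y ω)
          ((2 * q : ℕ) : ℝ≥0∞) P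
        ≤ lpNorm ((fun ω => ‖colMap a (x - y) ω‖) + fun _ : Ω => lam * ‖x - y‖)
            ((2 * q : ℕ) : ℝ≥0∞) P := by
          refine lpNorm_mono_ae hinc (hu.norm.add (memLp_top_const _)) _
            (Filter.Eventually.of_forall fun ω => ?_)
          have hle : |‖colMap a x ω‖ - ‖colMap a y ω‖| ≤ ‖colMap a (x - y) ω‖ := by
            rw [colMap_sub a]; exact abs_norm_sub_norm_le _ _
          have hle2 : |‖x‖ - ‖y‖| ≤ ‖x - y‖ := abs_norm_sub_norm_le _ _
          simp only [Pi.add_apply, Real.norm_eq_abs]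
          rw [abs_of_nonneg (by positivity : 0 ≤ ‖colMap a (x - y) ω‖ + lam * ‖x - y‖)]
          have : colDeviation a lam x ω - colDeviation a lam y ω =
              (‖colMap a x ω‖ - ‖colMap a y ω‖) - lam * (‖x‖ - ‖y‖) := by
            simp only [colDeviation]; ring
          rw [this]
          refine (abs_sub _ _).trans (add_le_add hle ?_)
          rw [abs_mul, abs_of_pos hlam]
          gcongr
      _ ≤ (lam + 4 * D) * ‖x - y‖ + lam * ‖x - y‖ := by
          refine (lpNorm_add_le (hu.norm.of_top _) hp1).trans (add_le_add ?_ (le_of_eq ?_))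
          · rw [lpNorm_norm hu.1]; exact hmap
          · exact hconst _ (by positivity)
      _ ≤ (D' + 4 * D') * ‖x - y‖ + D' * ‖x - y‖ := by gcongr
      _ ≤ _ := by nlinarith [mul_nonneg hD' (norm_nonneg (x - y))]

end Chaos

/-! ### Cells of partitions and chosen points -/

section Partition

variable {X : Type*}

lemma partitionCell_eq {c : Set (Set X)} (hc : Setoid.IsPartition c) {B : Set X} (hB : B ∈ c)
    {t : X} (ht : t ∈ B) : partitionCell c t = B := by
  ext s
  constructor
  · rintro ⟨A, hA, htA, hsA⟩
    rwa [(hc.2 t).unique ⟨hB, ht⟩ ⟨hA, htA⟩]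
  · exact fun hs => ⟨B, hB, ht, hs⟩

lemma partitionCell_mem {c : Set (Set X)} (hc : Setoid.IsPartition c) (t : X) :
    partitionCell c t ∈ c := by
  obtain ⟨B, hB, -⟩ := hc.2 t
  rw [partitionCell_eq hc hB.1 hB.2]
  exact hB.1

lemma mem_partitionCell {c : Set (Set X)} (hc : Setoid.IsPartition c) (t : X) :
    t ∈ partitionCell c t := by
  obtain ⟨B, hB, -⟩ := hc.2 t
  exact ⟨B, hB.1, hB.2, hB.2⟩

lemma partitionCell_eq_of_mem {c : Set (Set X)} (hc : Setoid.IsPartition c) {s t : X}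
    (hs : s ∈ partitionCell c t) : partitionCell c s = partitionCell c t :=
  partitionCell_eq hc (partitionCell_mem hc t) hs

lemma IsAdmissibleSeq.partitionCell_succ_subset {𝒜 : ℕ → Set (Set X)} (h : IsAdmissibleSeq 𝒜)
    (k : ℕ) (t : X) : partitionCell (𝒜 (k + 1)) t ⊆ partitionCell (𝒜 k) t := by
  obtain ⟨A, hA, hBA⟩ := h.refine_succ k _ (partitionCell_mem (h.isPartition (k + 1)) t)
  rwa [partitionCell_eq (h.isPartition k) hA (hBA (mem_partitionCell (h.isPartition (k + 1)) t))]

lemma IsAdmissibleSeq.exists_finset {𝒜 : ℕ → Set (Set X)} (h : IsAdmissibleSeq 𝒜) (k : ℕ) :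
    ∃ S : Finset (Set X), (S : Set (Set X)) = 𝒜 (k + 1) ∧ S.card ≤ 2 ^ 2 ^ (k + 1) := by
  have hc := h.card_le (k + 1) (by omega)
  have hfin : (𝒜 (k + 1)).Finite := by
    refine Set.encard_lt_top_iff.1 (hc.trans_lt ?_)
    exact_mod_cast ENat.natCast_lt_top (2 ^ 2 ^ (k + 1))
  refine ⟨hfin.toFinset, by simp, ?_⟩
  rw [hfin.encard_eq_coe_toFinset_card] at hc
  exact_mod_cast hc

/-- A point chosen in the cell of `t`; it depends on the cell only. -/
noncomputable def cellPoint [Nonempty X] (B : Set X) : X := Classical.epsilon (· ∈ B)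

lemma cellPoint_mem [Nonempty X] {c : Set (Set X)} (hc : Setoid.IsPartition c) (t : X) :
    cellPoint (partitionCell c t) ∈ partitionCell c t :=
  Classical.epsilon_spec (p := (· ∈ partitionCell c t)) ⟨t, mem_partitionCell hc t⟩

end Partition

/-! ### Generic chaining through moments -/

section Chaining

variable {X : Type*} [MetricSpace X] [Nonempty X]

/-- Deterministic chaining: the increments along the chosen points control the whole process. -/
lemma ofReal_abs_le_of_chain {𝒜 : ℕ → Set (Set X)} (h𝒜 : IsAdmissibleSeq 𝒜) {α : ℝ} (hα : 0 < α)
    {z : X → ℝ} (hz : Continuous z) {b : ℝ} (hb : 0 ≤ b) {l : ℕ} (t : X) {G : ℝ≥0∞} (hG : G ≠ ∞)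
    (ht : ∑' k : ℕ, ENNReal.ofReal ((2 : ℝ) ^ ((k : ℝ) / α)) *
      Metric.ediam (partitionCell (𝒜 k) t) ≤ G)
    (hinc : ∀ k, l ≤ k → |z (cellPoint (partitionCell (𝒜 (k + 1)) t)) -
        z (cellPoint (partitionCell (𝒜 k) t))| ≤ b * ((2 : ℝ) ^ ((k : ℝ) / α) *
      dist (cellPoint (partitionCell (𝒜 (k + 1)) t)) (cellPoint (partitionCell (𝒜 k) t)))) :
    ENNReal.ofReal |z t| ≤ ENNReal.ofReal |z (cellPoint (partitionCell (𝒜 l) t))| +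
      ENNReal.ofReal b * G := by
  set π : ℕ → X := fun k => cellPoint (partitionCell (𝒜 k) t) with hπ
  set g : ℕ → ℝ≥0∞ := fun k => ENNReal.ofReal ((2 : ℝ) ^ ((k : ℝ) / α)) *
      Metric.ediam (partitionCell (𝒜 k) t) with hg
  have hmem : ∀ k, π k ∈ partitionCell (𝒜 k) t := fun k => cellPoint_mem (h𝒜.isPartition k) t
  have hlim : Filter.Tendsto π Filter.atTop (nhds t) := by
    -- The weights are at least one, so a finite chaining sum forces the cell diameters to zero.
    rw [tendsto_iff_edist_tendsto_0]
    have h0 : Filter.Tendsto g Filter.atTop (nhds 0) :=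
      ENNReal.tendsto_atTop_zero_of_tsum_ne_top (ne_top_of_le_ne_top hG ht)
    refine tendsto_of_tendsto_of_tendsto_of_le_of_le tendsto_const_nhds h0
      (fun _ => zero_le) fun k => ?_
    calc edist (π k) t ≤ Metric.ediam (partitionCell (𝒜 k) t) :=
          Metric.edist_le_ediam_of_mem (hmem k) (mem_partitionCell (h𝒜.isPartition k) t)
      _ ≤ g k := by
          refine le_mul_of_one_le_left (zero_le) ?_
          rw [ENNReal.one_le_ofReal]
          exact Real.one_le_rpow (by norm_num) (by positivity)
  have hstep : ∀ k, edist (z (π (l + k))) (z (π (l + k.succ))) ≤ ENNReal.ofReal b * g (l + k) := by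
    intro k
    have h1 := hinc (l + k) (by omega)
    have h2 : edist (π (l + k + 1)) (π (l + k)) ≤ Metric.ediam (partitionCell (𝒜 (l + k)) t) :=
      Metric.edist_le_ediam_of_mem (h𝒜.partitionCell_succ_subset _ _ (hmem _)) (hmem _)
    rw [edist_comm, edist_dist, Real.dist_eq]
    refine (ENNReal.ofReal_le_ofReal h1).trans ?_
    rw [ENNReal.ofReal_mul hb, ENNReal.ofReal_mul (by positivity), ← edist_dist]
    simp only [hg]
    gcongr
  have hlim2 : Filter.Tendsto (fun k => z (π (l + k))) Filter.atTop (nhds (z t)) := by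
    have := (hz.tendsto t).comp (hlim.comp (Filter.tendsto_add_atTop_nat l))
    simpa [Function.comp_def, add_comm] using this
  have hsum := edist_le_tsum_of_edist_le_of_tendsto₀ _ hstep hlim2
  have hsum2 : ∑' k, ENNReal.ofReal b * g (l + k) ≤ ENNReal.ofReal b * G := by
    rw [ENNReal.tsum_mul_left]
    gcongr
    exact (ENNReal.tsum_comp_le_tsum_of_injective (add_right_injective l) g).trans ht
  have habs : |z t| ≤ |z (π l)| + dist (z (π l)) (z t) := by
    rw [Real.dist_eq, abs_sub_comm]
    have := abs_add_le (z (π l)) (z t - z (π l))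
    simpa using this
  refine (ENNReal.ofReal_le_ofReal habs).trans ?_
  rw [ENNReal.ofReal_add (abs_nonneg _) dist_nonneg, ← edist_dist]
  gcongr
  exact (by simpa using hsum : edist (z (π l)) (z t) ≤ _).trans hsum2

variable {Ω : Type*} [MeasurableSpace Ω] {P : Measure Ω} [IsProbabilityMeasure P]

/-- For `c = 0` the integrand is zero because division by zero gives zero, so degenerate links need
no separate treatment in the sums. -/
lemma lintegral_normalized_pow_le {f : Ω → ℝ} (hf : MemLp f ∞ P) {p : ℕ} (hp : p ≠ 0) {c D : ℝ}
    (hD : 0 < D) (hc : lpNorm f (p : ℝ≥0∞) P ≤ c) :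
    ∫⁻ ω, ENNReal.ofReal ((|f ω| / (D * c)) ^ p) ∂P ≤ ENNReal.ofReal (D⁻¹ ^ p) := by
  have hc0 : 0 ≤ c := lpNorm_nonneg.trans hc
  rcases eq_or_lt_of_le hc0 with rfl | hc0
  · simp [hp]
  have hint : Integrable (fun ω => (|f ω| / (D * c)) ^ p) P := by
    simp only [div_pow]
    exact ((memLp_top_pow hf.norm p).integrable le_top).div_const _
  rw [← ofReal_integral_eq_lintegral_ofReal hint
    (Filter.Eventually.of_forall fun ω => by positivity)]
  refine ENNReal.ofReal_le_ofReal ?_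
  simp only [div_pow]
  rw [integral_div]
  have h1 := lpNorm_pow_eq_integral hf hp
  simp only [Real.norm_eq_abs] at h1
  rw [← h1, div_le_iff₀ (by positivity), mul_pow, ← mul_assoc, ← mul_pow,
    inv_mul_cancel₀ hD.ne', one_pow, one_mul]
  exact pow_le_pow_left₀ lpNorm_nonneg hc p

/-- Generic chaining: a process whose increments have `L_p` norms of order `p ^ (1 / α)` for the
powers `p` of two is controlled, uniformly, by one random variable with bounded mean. -/
lemma exists_chaining_control {𝒜 : ℕ → Set (Set X)} (h𝒜 : IsAdmissibleSeq 𝒜) {α : ℝ} (hα : 0 < α)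
    {Z : X → Ω → ℝ} (hZ : ∀ t, MemLp (Z t) ∞ P) (hcont : ∀ ω, Continuous fun t => Z t ω)
    {L : ℝ} (hL : 0 < L) {ν : X → ℝ} (hν : ∀ t, 0 ≤ ν t) (hν0 : ∀ t ω, ν t = 0 → Z t ω = 0)
    (hone : ∀ k : ℕ, 1 ≤ k → ∀ t, lpNorm (Z t) ((2 ^ k : ℕ) : ℝ≥0∞) P ≤
      L * (2 : ℝ) ^ ((k : ℝ) / α) * ν t)
    (hinc : ∀ k : ℕ, 1 ≤ k → ∀ s t, lpNorm (fun ω => Z s ω - Z t ω) ((2 ^ k : ℕ) : ℝ≥0∞) P ≤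
      L * (2 : ℝ) ^ ((k : ℝ) / α) * dist s t)
    {R G : ℝ≥0∞} (hR : ∀ t, ENNReal.ofReal (ν t) ≤ R) (hG : G ≠ ∞)
    (hGt : ∀ t, ∑' k : ℕ, ENNReal.ofReal ((2 : ℝ) ^ ((k : ℝ) / α)) *
      Metric.ediam (partitionCell (𝒜 k) t) ≤ G) (j : ℕ) :
    ∃ Y : Ω → ℝ≥0∞, AEMeasurable Y P ∧ (∀ ω, 1 ≤ Y ω) ∧ ∫⁻ ω, Y ω ∂P ≤ 3 ∧
      ∀ ω (y : ℝ), 1 ≤ y → Y ω ≤ ENNReal.ofReal (y ^ 2 ^ (j + 1)) → ∀ t,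
        ENNReal.ofReal |Z t ω| ≤ ENNReal.ofReal (L * y) *
          (2 * ENNReal.ofReal ((2 : ℝ) ^ (((j + 1 : ℕ) : ℝ) / α)) * R + 8 * G) := by
  -- Index shift: `S k` lists the cells of `𝒜 (k + 1)`.
  choose S hS hScard using h𝒜.exists_finset
  set base : Set X → Ω → ℝ≥0∞ := fun A ω => ENNReal.ofReal ((|Z (cellPoint A) ω| /
    (2 * (L * (2 : ℝ) ^ (((j + 1 : ℕ) : ℝ) / α) * ν (cellPoint A)))) ^ 2 ^ (j + 1)) with hbase
  set par : ℕ → Set X → X := fun k A => cellPoint (partitionCell (𝒜 k) (cellPoint A)) with hpar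
  set link : ℕ → Set X → Ω → ℝ≥0∞ := fun k A ω =>
    ENNReal.ofReal ((|Z (cellPoint A) ω - Z (par k A) ω| /
      (8 * (L * (2 : ℝ) ^ ((k : ℝ) / α) * dist (cellPoint A) (par k A)))) ^ 2 ^ k) with hlink
  have hbase_m : ∀ A, AEMeasurable (base A) P := fun A =>
    (((hZ _).1.aemeasurable.abs.div_const _).pow_const _).ennreal_ofReal
  have hlink_m : ∀ k A, AEMeasurable (link k A) P := fun k A =>
    (((((hZ _).1.aemeasurable.sub (hZ _).1.aemeasurable).abs).div_const _).pow_const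
      _).ennreal_ofReal
  -- A link is determined by its finer cell alone, so a union over links is a sum over cells. The
  -- factors 2 and 8 beat the counts: `2^(2^(j+1))` cells against `2^(-2^(j+1))`, and `2^(2^(k+1)) =
  -- 4^(2^k)` cells against `8^(-2^k)`, leaving the summable `2^(-2^k)`.
  set U : Ω → ℝ≥0∞ := fun ω => ∑ A ∈ S j, base A ω with hU
  set V : ℕ → Ω → ℝ≥0∞ := fun k ω => ∑ A ∈ S (j + 1 + k), link (j + 1 + k) A ω with hV
  have hU_m : AEMeasurable U P := Finset.aemeasurable_fun_sum _ fun A _ => hbase_m A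
  have hV_m : ∀ k, AEMeasurable (V k) P := fun k =>
    Finset.aemeasurable_fun_sum _ fun A _ => hlink_m _ A
  have hUi : ∫⁻ ω, U ω ∂P ≤ 1 := by
    rw [lintegral_finsetSum' _ fun A _ => hbase_m A]
    calc ∑ A ∈ S j, ∫⁻ ω, base A ω ∂P
        ≤ ∑ _A ∈ S j, ENNReal.ofReal ((2 : ℝ)⁻¹ ^ 2 ^ (j + 1)) :=
          Finset.sum_le_sum fun A _ => lintegral_normalized_pow_le (hZ _) (by positivity)
            (by norm_num) (hone (j + 1) (by omega) _)
      _ ≤ ((2 ^ 2 ^ (j + 1) : ℕ) : ℝ≥0∞) * ENNReal.ofReal ((2 : ℝ)⁻¹ ^ 2 ^ (j + 1)) := by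
          rw [Finset.sum_const, nsmul_eq_mul]
          gcongr
          exact hScard j
      _ = 1 := by
          rw [← ENNReal.ofReal_natCast, ← ENNReal.ofReal_mul (by positivity)]
          push_cast
          rw [← mul_pow]
          norm_num
  have hVi : ∀ k, ∫⁻ ω, V k ω ∂P ≤ 2⁻¹ ^ (k + 1) := by
    intro k
    rw [lintegral_finsetSum' _ fun A _ => hlink_m _ A]
    calc ∑ A ∈ S (j + 1 + k), ∫⁻ ω, link (j + 1 + k) A ω ∂P
        ≤ ∑ _A ∈ S (j + 1 + k), ENNReal.ofReal ((8 : ℝ)⁻¹ ^ 2 ^ (j + 1 + k)) :=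
          Finset.sum_le_sum fun A _ => lintegral_normalized_pow_le ((hZ _).sub (hZ _))
            (by positivity) (by norm_num) (hinc (j + 1 + k) (by omega) _ _)
      _ ≤ ((2 ^ 2 ^ (j + 1 + k + 1) : ℕ) : ℝ≥0∞) *
          ENNReal.ofReal ((8 : ℝ)⁻¹ ^ 2 ^ (j + 1 + k)) := by
          rw [Finset.sum_const, nsmul_eq_mul]
          gcongr
          exact hScard _
      _ = ENNReal.ofReal (2⁻¹ ^ 2 ^ (j + 1 + k)) := by
          rw [← ENNReal.ofReal_natCast, ← ENNReal.ofReal_mul (by positivity)]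
          push_cast
          rw [pow_succ 2 (j + 1 + k), mul_comm _ 2, pow_mul, ← mul_pow]
          norm_num
      _ ≤ ENNReal.ofReal (2⁻¹ ^ (k + 1)) := by
          refine ENNReal.ofReal_le_ofReal (pow_le_pow_of_le_one (by norm_num) (by norm_num) ?_)
          have := Nat.lt_two_pow_self (n := j + 1 + k)
          omega
      _ = 2⁻¹ ^ (k + 1) := by
          rw [ENNReal.ofReal_pow (by norm_num), ENNReal.ofReal_inv_of_pos (by norm_num)]
          simp
  have hU1_m : AEMeasurable (fun ω => 1 + U ω) P := aemeasurable_const.add hU_m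
  refine ⟨fun ω => 1 + U ω + ∑' k, V k ω, ?_, fun ω => ?_, ?_, ?_⟩
  · exact hU1_m.add (AEMeasurable.tsum hV_m)
  · exact le_self_add.trans le_self_add
  · simp only
    rw [lintegral_add_left' hU1_m, lintegral_add_left' aemeasurable_const,
      lintegral_tsum hV_m]
    have h1 : ∑' k, ∫⁻ ω, V k ω ∂P ≤ 1 :=
      (ENNReal.tsum_le_tsum hVi).trans (le_of_eq (by
        rw [ENNReal.tsum_geometric_add_one, ENNReal.one_sub_inv_two, inv_inv,
          ENNReal.inv_mul_cancel (by norm_num) (by norm_num)]))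
    calc _ ≤ (1 : ℝ≥0∞) + 1 + 1 := by
          gcongr
          simp
      _ = 3 := by norm_num
  · intro ω y hy hYy t
    -- Finer levels carry higher powers, so `y ≥ 1` lets the single threshold `y^(2^(j+1))` bound
    -- every normalised increment by `y`.
    have hroot : ∀ {x : ℝ} {k : ℕ}, 0 ≤ x → j + 1 ≤ k →
        ENNReal.ofReal (x ^ 2 ^ k) ≤ ENNReal.ofReal (y ^ 2 ^ (j + 1)) → x ≤ y := by
      intro x k hx hk h
      rw [ENNReal.ofReal_le_ofReal_iff (by positivity)] at h
      refine le_of_pow_le_pow_left₀ (n := 2 ^ k) (by positivity) (by positivity) (h.trans ?_)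
      exact pow_le_pow_right₀ hy (Nat.pow_le_pow_right (by norm_num) hk)
    have hcell : ∀ k, partitionCell (𝒜 (k + 1)) t ∈ S k := fun k => by
      rw [← Finset.mem_coe, hS]; exact partitionCell_mem (h𝒜.isPartition _) t
    have hb : |Z (cellPoint (partitionCell (𝒜 (j + 1)) t)) ω| ≤
        y * (2 * (L * (2 : ℝ) ^ (((j + 1 : ℕ) : ℝ) / α) *
          ν (cellPoint (partitionCell (𝒜 (j + 1)) t)))) := by
      set s := cellPoint (partitionCell (𝒜 (j + 1)) t)
      rcases eq_or_lt_of_le (hν s) with h0 | h0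
      · rw [hν0 s ω h0.symm, ← h0]; simp
      · rw [← div_le_iff₀ (by positivity)]
        refine hroot (k := j + 1) (by positivity) le_rfl (le_trans ?_ hYy)
        calc base (partitionCell (𝒜 (j + 1)) t) ω ≤ U ω :=
              Finset.single_le_sum (f := fun A => base A ω) (fun _ _ => zero_le) (hcell j)
          _ ≤ 1 + U ω + ∑' k, V k ω := by
              exact le_add_self.trans le_self_add
    have hchain := ofReal_abs_le_of_chain h𝒜 hα (hcont ω) (b := y * (8 * L)) (by positivity)
      (l := j + 1) t hG (hGt t) (by
      intro k hk
      obtain ⟨i, rfl⟩ := Nat.exists_eq_add_of_le hk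
      -- By refinement, the chosen point of the finer cell lies in the coarser cell of `t`, so the
      -- link seen from `t` is the one indexed by the finer cell.
      have hpc : cellPoint (partitionCell (𝒜 (j + 1 + i)) t) =
          par (j + 1 + i) (partitionCell (𝒜 (j + 1 + i + 1)) t) := by
        simp only [hpar]
        rw [partitionCell_eq_of_mem (h𝒜.isPartition (j + 1 + i)) (t := t)
          (h𝒜.partitionCell_succ_subset _ _ (cellPoint_mem (h𝒜.isPartition _) t))]
      rw [hpc]
      set A := partitionCell (𝒜 (j + 1 + i + 1)) t
      rcases eq_or_lt_of_le (dist_nonneg (x := cellPoint A) (y := par (j + 1 + i) A)) with h0 | h0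
      · rw [← h0, dist_eq_zero.1 h0.symm]; simp
      · rw [show y * (8 * L) * ((2 : ℝ) ^ (((j + 1 + i : ℕ) : ℝ) / α) *
            dist (cellPoint A) (par (j + 1 + i) A)) = y * (8 * (L *
              (2 : ℝ) ^ (((j + 1 + i : ℕ) : ℝ) / α) *
                dist (cellPoint A) (par (j + 1 + i) A))) by ring,
          ← div_le_iff₀ (by positivity)]
        refine hroot (k := j + 1 + i) (by positivity) (by omega) (le_trans ?_ hYy)
        calc link (j + 1 + i) A ω ≤ V i ω :=
              Finset.single_le_sum (f := fun A => link (j + 1 + i) A ω) (fun _ _ => zero_le)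
                (hcell (j + 1 + i))
          _ ≤ ∑' k, V k ω := ENNReal.le_tsum i
          _ ≤ 1 + U ω + ∑' k, V k ω := le_add_self)
    refine hchain.trans ?_
    calc _ ≤ ENNReal.ofReal (y * (2 * (L * (2 : ℝ) ^ (((j + 1 : ℕ) : ℝ) / α) *
          ν (cellPoint (partitionCell (𝒜 (j + 1)) t))))) + ENNReal.ofReal (y * (8 * L)) * G := by
          gcongr
      _ ≤ ENNReal.ofReal (L * y) * (2 * ENNReal.ofReal ((2 : ℝ) ^ (((j + 1 : ℕ) : ℝ) / α)) * R) +
          ENNReal.ofReal (L * y) * (8 * G) := by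
          gcongr ?_ + ?_
          · rw [show y * (2 * (L * (2 : ℝ) ^ (((j + 1 : ℕ) : ℝ) / α) *
              ν (cellPoint (partitionCell (𝒜 (j + 1)) t)))) = L * y * (2 *
                (2 : ℝ) ^ (((j + 1 : ℕ) : ℝ) / α) * ν (cellPoint (partitionCell (𝒜 (j + 1)) t)))
                by ring, ENNReal.ofReal_mul (by positivity), ENNReal.ofReal_mul (by positivity),
              ENNReal.ofReal_mul (by positivity)]
            gcongr
            · simp
            · exact hR _
          · rw [show y * (8 * L) = L * y * 8 by ring, ENNReal.ofReal_mul (by positivity), mul_assoc]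
            simp
      _ = _ := by rw [mul_add]

end Chaining

/-! ### Near-optimal admissible sequences -/

section Gamma

variable {X : Type*}

lemma IsAdmissibleSeq.nonempty {𝒜 : ℕ → Set (Set X)} (h : IsAdmissibleSeq 𝒜) : Nonempty X := by
  obtain ⟨B, hB⟩ := Set.encard_eq_one.1 h.card_zero
  have hmem : B ∈ 𝒜 0 := by rw [hB]; rfl
  obtain ⟨x, -⟩ := Set.nonempty_iff_ne_empty.2 fun h0 => (h.isPartition 0).1 (h0 ▸ hmem)
  exact ⟨x⟩

lemma IsAdmissibleSeq.partitionCell_zero {𝒜 : ℕ → Set (Set X)} (h : IsAdmissibleSeq 𝒜) (t : X) :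
    partitionCell (𝒜 0) t = Set.univ := by
  obtain ⟨B, hB⟩ := Set.encard_eq_one.1 h.card_zero
  refine Set.eq_univ_of_forall fun s => ?_
  have hs := partitionCell_mem (h.isPartition 0) s
  have ht := partitionCell_mem (h.isPartition 0) t
  have hst : partitionCell (𝒜 0) t = partitionCell (𝒜 0) s :=
    (Set.mem_singleton_iff.1 (hB.subset ht)).trans (Set.mem_singleton_iff.1 (hB.subset hs)).symm
  rw [hst]
  exact mem_partitionCell (h.isPartition 0) s

variable [MetricSpace X]

/-- An admissible sequence that is optimal up to a factor two. -/
lemma exists_admissible_le {α : ℝ} (hγ : talagrandGamma α X ≠ ∞) :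
    ∃ 𝒜 : ℕ → Set (Set X), IsAdmissibleSeq 𝒜 ∧
      ∀ t, ∑' k : ℕ, ENNReal.ofReal ((2 : ℝ) ^ ((k : ℝ) / α)) *
        Metric.ediam (partitionCell (𝒜 k) t) ≤ 2 * talagrandGamma α X := by
  -- If `γ = 0`, doubling gives no room above the infimum; but the zeroth term shows that the whole
  -- space has diameter zero, so any admissible sequence works.
  rcases eq_or_ne (talagrandGamma α X) 0 with h0 | h0
  · have h1 : talagrandGamma α X < 1 := by rw [h0]; exact one_pos
    have hdiam : Metric.ediam (Set.univ : Set X) ≤ talagrandGamma α X := by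
      refine le_iInf₂ fun 𝒜 h𝒜 => ?_
      obtain ⟨t⟩ := h𝒜.nonempty
      refine le_trans ?_ (le_iSup _ t)
      refine le_trans ?_ (ENNReal.le_tsum 0)
      simp [h𝒜.partitionCell_zero]
    have hcell : ∀ B : Set X, Metric.ediam B = 0 := fun B =>
      le_antisymm (((Metric.ediam_mono (Set.subset_univ B)).trans hdiam).trans h0.le) zero_le
    simp only [talagrandGamma, iInf_lt_iff] at h1
    obtain ⟨𝒜, h𝒜, -⟩ := h1
    exact ⟨𝒜, h𝒜, fun t => by simp [hcell]⟩
  · have h1 : talagrandGamma α X < 2 * talagrandGamma α X := by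
      rw [two_mul]
      exact ENNReal.lt_add_right hγ h0
    conv_lhs at h1 => rw [talagrandGamma]
    simp only [iInf_lt_iff] at h1
    obtain ⟨𝒜, h𝒜, hlt⟩ := h1
    exact ⟨𝒜, h𝒜, fun t => (le_iSup (fun t => ∑' k : ℕ, ENNReal.ofReal ((2 : ℝ) ^ ((k : ℝ) / α)) *
        Metric.ediam (partitionCell (𝒜 k) t)) t).trans hlt.le⟩

end Gamma

/-! ### Uniform control of the deviation -/

section Deviation

variable {Ω : Type*} [MeasurableSpace Ω] {P : Measure Ω} [IsProbabilityMeasure P]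
  {m n : ℕ} {a : Fin n → Ω → EuclideanSpace ℝ (Fin m)} {α B lam : ℝ}

/-- One random variable of mean at most three controls the deviation on `T`. -/
lemma IsWeibullColumns.exists_control (h : IsWeibullColumns P α B lam a)
    (hα : 0 < α) (hα2 : α ≤ 2) (hB : 0 < B) (hlam : 0 < lam) (T : Set (EuclideanSpace ℝ (Fin n)))
    (hγ : talagrandGamma α T ≠ ∞) (j : ℕ) :
    ∃ Y : Ω → ℝ≥0∞, AEMeasurable Y P ∧ (∀ ω, 1 ≤ Y ω) ∧ ∫⁻ ω, Y ω ∂P ≤ 3 ∧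
      ∀ ω (y : ℝ), 1 ≤ y → Y ω ≤ ENNReal.ofReal (y ^ 2 ^ (j + 1)) → ∀ x ∈ T,
        ENNReal.ofReal |colDeviation a lam x ω| ≤
          ENNReal.ofReal (120 * 2 ^ (1 / α) * B * y) *
            (2 * ENNReal.ofReal ((2 : ℝ) ^ (((j + 1 : ℕ) : ℝ) / α)) * setRad T +
              16 * talagrandGamma α T) := by
  obtain ⟨𝒜, h𝒜, hle⟩ := exists_admissible_le hγ
  have : Nonempty T := h𝒜.nonempty
  have hpow : ∀ k : ℕ, ((2 ^ k : ℕ) : ℝ) ^ (1 / α) = (2 : ℝ) ^ ((k : ℝ) / α) := by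
    intro k
    push_cast
    rw [← Real.rpow_natCast, ← Real.rpow_mul (by norm_num)]
    congr 1; ring
  have h2α : (1 : ℝ) ≤ 2 ^ (1 / α) := Real.one_le_rpow (by norm_num) (by positivity)
  have hexp : ∀ k : ℕ, 1 ≤ k → 2 ^ k = 2 * 2 ^ (k - 1) := by
    intro k hk
    rw [← pow_succ']; congr 1; omega
  obtain ⟨Y, hYm, hY1, hYi, hY⟩ := exists_chaining_control (P := P) h𝒜 hα
    (Z := fun t : T => colDeviation a lam (t : EuclideanSpace ℝ (Fin n)))
    (fun t => h.memLp_colDeviation t)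
    (fun ω => by unfold colDeviation colMap colComb; fun_prop)
    (L := 120 * 2 ^ (1 / α) * B) (by positivity)
    (ν := fun t : T => ‖(t : EuclideanSpace ℝ (Fin n))‖) (fun t => norm_nonneg _)
    (fun t ω h0 => by
      have h0' : (t : EuclideanSpace ℝ (Fin n)) = 0 := norm_eq_zero.1 h0
      simp [colDeviation, colMap, colComb, h0'])
    (fun k hk t => by
      have h1 := h.lpNorm_colDeviation_le hα hα2 hB.le hlam (q := 2 ^ (k - 1))
        (Nat.one_le_two_pow) (t : EuclideanSpace ℝ (Fin n))
      rw [← hexp k hk, hpow] at h1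
      refine h1.trans ?_
      rw [show 120 * 2 ^ (1 / α) * B * (2 : ℝ) ^ ((k : ℝ) / α) *
        ‖(t : EuclideanSpace ℝ (Fin n))‖ = 120 * 2 ^ (1 / α) * ((2 : ℝ) ^ ((k : ℝ) / α) * B) *
        ‖(t : EuclideanSpace ℝ (Fin n))‖ by ring]
      gcongr
      linarith)
    (fun k hk s t => by
      have h1 := h.lpNorm_colDeviation_sub_le hα hα2 hB.le hlam (q := 2 ^ (k - 1))
        (Nat.one_le_two_pow) (s : EuclideanSpace ℝ (Fin n)) (t : EuclideanSpace ℝ (Fin n))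
      rw [← hexp k hk, hpow] at h1
      rw [Subtype.dist_eq, dist_eq_norm]
      exact h1)
    (R := setRad T) (G := 2 * talagrandGamma α T)
    (fun t => le_iSup₂ (f := fun (x : EuclideanSpace ℝ (Fin n)) (_ : x ∈ T) =>
      ENNReal.ofReal ‖x‖) t.1 t.2)
    (ENNReal.mul_ne_top (by simp) hγ) hle j
  refine ⟨Y, hYm, hY1, hYi, fun ω y hy hYy x hx => (hY ω y hy hYy ⟨x, hx⟩).trans (le_of_eq ?_)⟩
  rw [← mul_assoc (8 : ℝ≥0∞)]
  norm_num

/-- The columns cannot be small in every direction. -/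
lemma IsWeibullColumns.scale_ne_zero (h : IsWeibullColumns P α B lam a) (hlam : 0 < lam)
    (i : Fin n) : B ≠ 0 := by
  rintro rfl
  have hz : ∀ k : Fin m, ∫ ω, a i ω k ^ 2 ∂P = 0 := by
    intro k
    have := h.moment i (EuclideanSpace.single k 1) 1
    refine le_antisymm ?_ (integral_nonneg fun ω => sq_nonneg _)
    simp [EuclideanSpace.inner_single_right] at this
    linarith
  have hsq : ∫ ω, ‖a i ω‖ ^ 2 ∂P = 0 := by
    simp_rw [EuclideanSpace.real_norm_sq_eq]
    rw [integral_finsetSum]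
    · simp [hz]
    · intro k _
      have : MemLp (fun ω => a i ω k) ∞ P := (h.memLp i).mono
        (((EuclideanSpace.proj (𝕜 := ℝ) k).continuous.measurable.comp
          (h.measurable i)).aestronglyMeasurable)
        (Filter.Eventually.of_forall fun ω => PiLp.norm_apply_le (a i ω) k)
      exact (memLp_top_pow this 2).integrable le_top
  have hc : ∫ ω, ‖a i ω‖ ^ 2 ∂P = lam ^ 2 := by
    rw [integral_congr_ae ((h.norm_eq i).mono fun ω hω => by simp only [hω] :
      (fun ω => ‖a i ω‖ ^ 2) =ᵐ[P] fun _ => lam ^ 2)]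
    simp
  rw [hsq] at hc
  exact (pow_pos hlam 2).ne hc

lemma IsWeibullColumns.of_psiNormVec_le (hα : 0 < α) {K : ℝ} (hK : 0 ≤ K)
    (hmeas : ∀ i, Measurable (a i)) (hind : iIndepFun a P) (h0 : ∀ i, ∫ ω, a i ω ∂P = 0)
    (hnorm : ∀ i, ∀ᵐ ω ∂P, ‖a i ω‖ = lam)
    (hpsi : ∀ i, psiNormVec P α (a i) ≤ ENNReal.ofReal K) :
    IsWeibullColumns P α (√32 * α ^ (-1 / α) * K) lam a := by
  refine ⟨hmeas, hind, h0, hnorm, fun i w k => ?_⟩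
  have hX : MemLp (a i) ∞ P := memLp_top_of_bound (hmeas i).aestronglyMeasurable lam
    ((hnorm i).mono fun _ h => h.le)
  -- The moment bound requires a positive scale; letting `K'` decrease to `K` covers `K = 0`.
  have hlim : Filter.Tendsto (fun K' : ℝ => momentWeight (1 / α - 1 / 2) k *
      (32 * (α ^ (-1 / α)) ^ 2 * K' ^ 2 * ‖w‖ ^ 2) ^ k) (nhdsWithin K (Set.Ioi K))
      (nhds (momentWeight (1 / α - 1 / 2) k *
        (32 * (α ^ (-1 / α)) ^ 2 * K ^ 2 * ‖w‖ ^ 2) ^ k)) := by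
    refine Filter.Tendsto.mono_left ?_ nhdsWithin_le_nhds
    exact Continuous.tendsto (by fun_prop) K
  have hmain := ge_of_tendsto hlim (Filter.eventually_of_mem self_mem_nhdsWithin
    fun K' (hK' : K < K') => integral_inner_even_pow_le hα hX (hK.trans_lt hK')
      ((hpsi i).trans (ENNReal.ofReal_le_ofReal hK'.le)) w k)
  refine hmain.trans (le_of_eq ?_)
  rw [mul_pow (√32 * _), mul_pow √32, Real.sq_sqrt (by norm_num)]

end Deviation

lemma colMap_euclideanCol {Ω : Type*} {m n : ℕ} (A : Ω → Matrix (Fin m) (Fin n) ℝ)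
    (x : EuclideanSpace ℝ (Fin n)) (ω : Ω) :
    colMap (fun i ω => euclideanCol (A ω) i) x ω = WithLp.toLp 2 (A ω *ᵥ x.ofLp) := by
  ext k
  simp [colComb, euclideanCol, Matrix.mulVec, dotProduct, mul_comm]

/-! ### Expectation and tail bounds -/

theorem mainTheorem4 :
    ∃ C : ℝ, 0 < C ∧ ∀ α : ℝ, 0 < α → α ≤ 2 → ∃ Cα : ℝ≥0, 0 < Cα ∧
      ∀ (Ω : Type*) [MeasurableSpace Ω] (P : Measure Ω) [IsProbabilityMeasure P]
        (m n : ℕ) (A : Ω → Matrix (Fin m) (Fin n) ℝ) (lam : ℝ) (K : ℝ≥0)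
        (T : Set (EuclideanSpace ℝ (Fin n))),
        0 < lam →
        (∀ i, Measurable (fun ω => euclideanCol (A ω) i)) →
        iIndepFun (fun i ω => euclideanCol (A ω) i) P →
        (∀ i, ∫ ω, euclideanCol (A ω) i ∂P = 0) →
        (∀ i, ∀ᵐ ω ∂P, ‖euclideanCol (A ω) i‖ = lam) →
        (∀ i, psiNormVec P α (fun ω => euclideanCol (A ω) i) ≤ K) →
        (∫⁻ ω, supDistortion (A ω) lam T ∂P ≤ Cα * K * (talagrandGamma α T + setRad T)) ∧
        (∀ u : ℝ, 0 ≤ u →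
          ENNReal.ofReal (1 - C * Real.exp (-(u ^ α))) ≤
            P {ω | supDistortion (A ω) lam T ≤
              Cα * K * (talagrandGamma α T + ENNReal.ofReal u * setRad T)}) := by
  refine ⟨3, by norm_num, fun α hα hα2 => ?_⟩
  have hD0 : 0 < 48 * (2 : ℝ) ^ (1 / α) * (120 * 2 ^ (1 / α) * (√32 * α ^ (-1 / α))) := by
    positivity
  -- Here `48 = 3 · 16`: the 3 is the mean of `Y` or the tail level `y = 3`, and the 16 is the
  -- coefficient of `γ`. The first `2^(1/α)` comes from rounding `u^α` up to a power of two.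
  set D : ℝ := 48 * (2 : ℝ) ^ (1 / α) * (120 * 2 ^ (1 / α) * (√32 * α ^ (-1 / α))) with hD
  refine ⟨D.toNNReal, Real.toNNReal_pos.2 hD0, ?_⟩
  intro Ω _ P _ m n A lam K T hlam hmeas hind hmean hnorm hpsi
  have hprob : ∀ c : ℝ≥0∞, (∀ ω, supDistortion (A ω) lam T ≤ c) → ∀ u : ℝ, 0 ≤ u →
      ENNReal.ofReal (1 - 3 * Real.exp (-(u ^ α))) ≤ P {ω | supDistortion (A ω) lam T ≤ c} := by
    intro c hc u hu
    rw [Set.eq_univ_of_forall (s := {ω | supDistortion (A ω) lam T ≤ c}) hc, measure_univ]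
    refine ENNReal.ofReal_le_one.2 ?_
    linarith [Real.exp_pos (-(u ^ α))]
  -- Without columns nothing forces `K > 0`; with one, `scale_ne_zero` does.
  rcases Nat.eq_zero_or_pos n with rfl | hn
  · have hz : ∀ ω, supDistortion (A ω) lam T = 0 := by
      intro ω
      have h1 : ∀ x : EuclideanSpace ℝ (Fin 0), A ω *ᵥ x.ofLp = 0 := fun x => by
        ext k; simp [Matrix.mulVec, dotProduct]
      have h2 : ∀ x : EuclideanSpace ℝ (Fin 0), x = 0 := fun x => Subsingleton.elim _ _
      simp [supDistortion, h1, fun x => h2 x]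
    exact ⟨by simp [hz], fun u hu => hprob _ (fun ω => by simp [hz]) u hu⟩
  set a : Fin n → Ω → EuclideanSpace ℝ (Fin m) := fun i ω => euclideanCol (A ω) i with ha
  have hcol : IsWeibullColumns P α (√32 * α ^ (-1 / α) * K) lam a :=
    .of_psiNormVec_le hα K.2 hmeas hind hmean hnorm fun i => by simpa using hpsi i
  have hB : 0 < √32 * α ^ (-1 / α) * (K : ℝ) :=
    lt_of_le_of_ne (by positivity) (hcol.scale_ne_zero hlam ⟨0, hn⟩).symm
  have hK : K ≠ 0 := by rintro rfl; simp at hB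
  have hDK : ((D.toNNReal : ℝ≥0) : ℝ≥0∞) * K = ENNReal.ofReal (D * K) := by
    rw [ENNReal.ofReal_mul hD0.le]; simp [ENNReal.ofReal]
  -- This case includes the empty `T`, which has no admissible sequence. The right side is infinite
  -- because `K ≠ 0` excludes `0 · ∞`.
  rcases eq_or_ne (talagrandGamma α T) ∞ with hγ | hγ
  · have htop : ∀ c : ℝ≥0∞, ((D.toNNReal : ℝ≥0) : ℝ≥0∞) * K * (talagrandGamma α T + c) = ∞ := by
      intro c
      rw [hγ, top_add, ENNReal.mul_top]
      exact mul_ne_zero (by simpa using hD0) (by simpa using hK)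
    exact ⟨by rw [htop]; exact le_top,
      fun u hu => hprob _ (fun ω => by rw [htop]; exact le_top) u hu⟩
  have hsup : ∀ ω (c : ℝ≥0∞), (∀ x ∈ T, ENNReal.ofReal |colDeviation a lam x ω| ≤ c) →
      supDistortion (A ω) lam T ≤ c := by
    intro ω c hc
    refine iSup₂_le fun x hx => ?_
    have := hc x hx
    rwa [colDeviation, ha, colMap_euclideanCol] at this
  have h2α : (1 : ℝ) ≤ 2 ^ (1 / α) := Real.one_le_rpow (by norm_num) (by positivity)
  have hfinal : ∀ u : ℝ, 0 ≤ u → ENNReal.ofReal (120 * 2 ^ (1 / α) * (√32 * α ^ (-1 / α) * K) * 3) *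
      (2 * ENNReal.ofReal ((2 : ℝ) ^ (1 / α) * u) * setRad T + 16 * talagrandGamma α T) ≤
      (D.toNNReal : ℝ≥0) * K * (talagrandGamma α T + ENNReal.ofReal u * setRad T) := by
    intro u hu
    set b := 120 * 2 ^ (1 / α) * (√32 * α ^ (-1 / α) * (K : ℝ)) * 3 with hb
    have hb0 : 0 ≤ b := by positivity
    have hDb : D * K = b * (16 * 2 ^ (1 / α)) := by rw [hD, hb]; ring
    rw [hDK, hDb, ENNReal.ofReal_mul hb0, mul_assoc (ENNReal.ofReal b)]
    gcongr
    rw [mul_add, add_comm]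
    gcongr ?_ + ?_
    · gcongr
      rw [show (16 : ℝ≥0∞) = ENNReal.ofReal 16 by simp]
      exact ENNReal.ofReal_le_ofReal (by linarith)
    · rw [← mul_assoc]
      gcongr ?_ * _
      rw [show (2 : ℝ≥0∞) = ENNReal.ofReal 2 by simp, ← ENNReal.ofReal_mul (by norm_num),
        ← ENNReal.ofReal_mul (by positivity)]
      refine ENNReal.ofReal_le_ofReal ?_
      nlinarith [mul_nonneg (zero_le_one.trans h2α) hu]
  constructor
  -- For the mean take `j = 0` and the random level `y = Y`, allowed since `Y ≤ Y²` for `Y ≥ 1`; the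
  -- bound is then linear in `Y`.
  · obtain ⟨Y, hYm, hY1, hYi, hY⟩ := hcol.exists_control hα hα2 hB hlam T hγ 0
    set b := 120 * 2 ^ (1 / α) * (√32 * α ^ (-1 / α) * (K : ℝ)) with hb
    have hb0 : 0 ≤ b := by positivity
    set Q := 2 * ENNReal.ofReal ((2 : ℝ) ^ (((0 + 1 : ℕ) : ℝ) / α)) * setRad T +
      16 * talagrandGamma α T with hQ
    have hfin : ∀ᵐ ω ∂P, Y ω < ∞ := ae_lt_top' hYm (ne_top_of_le_ne_top (by simp) hYi)
    calc ∫⁻ ω, supDistortion (A ω) lam T ∂P ≤ ∫⁻ ω, (ENNReal.ofReal b * Q) * Y ω ∂P := by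
          refine lintegral_mono_ae (hfin.mono fun ω hω => hsup ω _ fun x hx => ?_)
          have hy1 : 1 ≤ (Y ω).toReal := by
            rw [← ENNReal.toReal_one]; exact ENNReal.toReal_mono hω.ne (hY1 ω)
          refine (hY ω (Y ω).toReal hy1 ?_ x hx).trans (le_of_eq ?_)
          · calc Y ω = ENNReal.ofReal (Y ω).toReal := (ENNReal.ofReal_toReal hω.ne).symm
              _ ≤ _ := ENNReal.ofReal_le_ofReal (le_self_pow₀ hy1 (by norm_num))
          · rw [ENNReal.ofReal_mul hb0, ENNReal.ofReal_toReal hω.ne]; ring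
      _ = (ENNReal.ofReal b * Q) * ∫⁻ ω, Y ω ∂P := lintegral_const_mul'' _ hYm
      _ ≤ (ENNReal.ofReal b * Q) * 3 := by gcongr
      _ = ENNReal.ofReal (b * 3) * (2 * ENNReal.ofReal ((2 : ℝ) ^ (1 / α) * 1) * setRad T +
            16 * talagrandGamma α T) := by
          rw [ENNReal.ofReal_mul hb0, hQ]
          simp only [zero_add, Nat.cast_one, mul_one, ENNReal.ofReal_ofNat]
          ring
      _ ≤ _ := by simpa using hfinal 1 zero_le_one
  · intro u hu
    -- For `u < 1` the claim is empty, because `3 e⁻¹ > 1`.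
    rcases lt_or_ge u 1 with hu1 | hu1
    · have hle : 1 - 3 * Real.exp (-(u ^ α)) ≤ 0 := by
        have h1 : u ^ α ≤ 1 := Real.rpow_le_one hu hu1.le hα.le
        have h2 : Real.exp (-1) ≤ Real.exp (-(u ^ α)) := Real.exp_le_exp.2 (by linarith)
        have h3 : Real.exp (-1) * Real.exp 1 = 1 := by rw [← Real.exp_add]; simp
        nlinarith [Real.exp_one_lt_three, Real.exp_pos (-1)]
      rw [ENNReal.ofReal_of_nonpos hle]
      exact zero_le
    have hs1 : 1 ≤ u ^ α := Real.one_le_rpow hu1 hα.le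
    -- The starting level satisfies `2^j ≤ u^α < 2^(j+1) = p`. Hence `p^(1/α) ≤ 2^(1/α) u`, while
    -- Markov at level `3^p ≥ e^p ≥ exp (u^α)` gives the tail with constant 3.
    obtain ⟨j, hj1, hj2⟩ := exists_nat_pow_near hs1 (by norm_num : (1 : ℝ) < 2)
    obtain ⟨Y, hYm, hY1, hYi, hY⟩ := hcol.exists_control hα hα2 hB hlam T hγ j
    set p := 2 ^ (j + 1) with hp
    have hroot : (2 : ℝ) ^ (((j + 1 : ℕ) : ℝ) / α) ≤ 2 ^ (1 / α) * u := by
      calc (2 : ℝ) ^ (((j + 1 : ℕ) : ℝ) / α) = ((2 : ℝ) ^ (j + 1)) ^ (1 / α) := by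
            rw [← Real.rpow_natCast, ← Real.rpow_mul (by norm_num)]; congr 1; ring
        _ ≤ (2 * u ^ α) ^ (1 / α) := by
            refine Real.rpow_le_rpow (by positivity) ?_ (by positivity)
            rw [pow_succ']; linarith
        _ = _ := by
            rw [Real.mul_rpow (by norm_num) (by positivity), ← Real.rpow_mul hu,
              mul_one_div_cancel hα.ne', Real.rpow_one]
    have hsub : {ω | Y ω ≤ ENNReal.ofReal (3 ^ p)} ⊆ {ω | supDistortion (A ω) lam T ≤
        (D.toNNReal : ℝ≥0) * K * (talagrandGamma α T + ENNReal.ofReal u * setRad T)} := by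
      intro ω hω
      refine (hsup ω _ fun x hx => ?_).trans (hfinal u hu)
      refine (hY ω 3 (by norm_num) hω x hx).trans ?_
      gcongr
    refine le_trans ?_ (measure_mono hsub)
    have hmarkov : P {ω | ENNReal.ofReal (3 ^ p) ≤ Y ω} ≤
        ENNReal.ofReal (3 * Real.exp (-(u ^ α))) := by
      refine (meas_ge_le_lintegral_div hYm (by simp) ENNReal.ofReal_ne_top).trans ?_
      have hexp : Real.exp (u ^ α) ≤ 3 ^ p := by
        calc Real.exp (u ^ α) ≤ Real.exp ((p : ℕ) : ℝ) := by
              refine Real.exp_le_exp.2 ?_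
              rw [hp]; push_cast; exact hj2.le
          _ = Real.exp 1 ^ p := by rw [← Real.exp_nat_mul, mul_one]
          _ ≤ 3 ^ p := pow_le_pow_left₀ (Real.exp_pos _).le Real.exp_one_lt_three.le p
      calc (∫⁻ ω, Y ω ∂P) / ENNReal.ofReal (3 ^ p)
          ≤ ENNReal.ofReal 3 / ENNReal.ofReal (Real.exp (u ^ α)) := by
            gcongr
            simpa using hYi
        _ = _ := by
            rw [← ENNReal.ofReal_div_of_pos (Real.exp_pos _), Real.exp_neg, div_eq_mul_inv]
    rw [ENNReal.ofReal_sub _ (by positivity), ENNReal.ofReal_one]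
    refine tsub_le_iff_right.2 ?_
    calc (1 : ℝ≥0∞) = P Set.univ := measure_univ.symm
      _ ≤ P ({ω | Y ω ≤ ENNReal.ofReal (3 ^ p)} ∪ {ω | ENNReal.ofReal (3 ^ p) ≤ Y ω}) :=
          measure_mono fun ω _ => le_total (Y ω) (ENNReal.ofReal (3 ^ p))
      _ ≤ _ := (measure_union_le _ _).trans (by gcongr)
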